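/- Let $(w_n)_{n\ge 1}$ be non-negative reals with $w_1>0$ and $W_n=\sum_{i=1}^n w_i$. Let $(\mathtt T_n)_{n\ge1}$ be the weighted recursive tree with these weights: $\mathtt T_1$ consists of a root labelled $1$, and $\mathtt T_{n+1}$ is obtained from $\mathtt T_n$ by adding a vertex labelled $n+1$ whose parent is the vertex labelled $k$ with conditional probability $w_k/W_n$ given $\mathtt T_n$, for $1\le k\le n$. Let $\mathrm{ht}(\mathtt T_n)$ be the height of $\mathtt T_n$, the maximal distance of a vertex to the root. Let $(i_r)_{r\ge 0}$ be a strictly increasing sequence of integers with $i_0=1$, put $i_{-1}=0$ and, for $n\ge1$, let $t_n$ be the unique integer $r\ge0$ such that $i_{r-1}+1\le n\le i_r$. Assume that are given * a non-decreasing sequence $(T(n))_{n\ge2}$ of non-negative integers such that $T(n)<t_n$ for every $n\ge2$ and $T(n)\to\infty$ as $n\to\infty$; * a sequence $(\theta_r)_{r\ge1}$ of real numbers such that, for some $r_0\ge1$, $(\theta_r)_{r\ge r_0}$ is a non-decreasing sequence of non-negative numbers. Let $(Y_i)_{i\ge2}$ be independent random variables, $Y_i$ being Bernoulli with parameter $$p_i=\frac{e^{\theta_{t_i}}\frac{w_i}{W_i}}{1+(e^{\theta_{t_i}}-1)\frac{w_i}{W_i}},$$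 and, for given $n$, set $S_0=0$ and $S_r=\sum_{s=1}^r(X_s-1)$ for $r\ge1$, where $X_s=\sum_{i=i_{s-1}+1}^{\min(i_s,n)}Y_i$. Define, for $n\ge2$, $$E(n)=\mathbb E\left[\exp\left(\sum_{r=1}^{t_n-T(n)-1}(\theta_{T(n)+r+1}-\theta_{T(n)+r})(S_{T(n)+r}-S_{T(n)})\right)\mathbf 1_{\{S_{t_n}=S_{T(n)},\ \forall\, 0\le r<t_n-T(n),\ S_{T(n)+r}\le S_{T(n)}\}}\right],$$ $$\delta_1(n)=\sum_{i\ge i_{T(n)}+1}e^{2\theta_{t_i}}\frac{w_i^2}{W_i^2},$$ $$\delta_2(n)=\sum_{\ell\ge i_{T(n)}+1}e^{2\theta_{t_\ell}}\frac{w_\ell^2}{W_\ell^2}\exp\left(\sum_{r=T(n)+1}^{t_\ell-1}\theta_r-\sum_{i=i_{T(n)}+1}^{i_{t_\ell-1}}(e^{\theta_{t_i}}-1)\frac{w_i}{W_i}\right).$$ If $E(i_t)\neq0$ for every $t\ge1$ and $$\sum_{t\ge1}\delta_1(i_t)<\infty\qquad\text{and}\qquad\sum_{t\ge1}\frac{\delta_2(i_t)}{E(i_t)^2}<\infty,$$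 then almost surely, for all $n$ large enough, $\mathrm{ht}(\mathtt T_n)\ge t_n-T(n)-1$. -/

import Mathlib

open MeasureTheory ProbabilityTheory Filter
open scoped ENNReal

noncomputable section

namespace WRT

/-! ### Weighted recursive trees

A growing sequence of rooted trees `T_1, T_2, …`, where `T_n` has vertices `u_1, …, u_n` labelled
`1, …, n` and root `u_1`, is encoded by its parent labels: `K m` is the label of the parent of
`u_m`, for `m ≥ 2`. The values `K 0` and `K 1` play no role. -/

/-- Total weight `W_n = w_1 + ⋯ + w_n`; the value `w 0` plays no role. -/
def totalWeight (w : ℕ → ℝ) (n : ℕ) : ℝ := ∑ j ∈ Finset.Icc 1 n, w j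

/-- Height (distance to the root) of the vertex labelled `m` in the tree with parent labels `K`:
`0` for the root, and one more than the height of the parent for every other vertex. -/
def vertexHeight (K : ℕ → ℕ) (m : ℕ) : ℕ :=
  if _h : 1 ≤ K m ∧ K m < m then vertexHeight K (K m) + 1 else 0
termination_by m
decreasing_by exact _h.2

/-- Height of the tree `T_n`: the maximal height of its vertices `u_1, …, u_n`. -/
def treeHeight (K : ℕ → ℕ) (n : ℕ) : ℕ := (Finset.Icc 1 n).sup (vertexHeight K)

/-- The σ-algebra generated by the labelled tree `T_n`, that is, by `K_2, …, K_n`. -/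
abbrev treeSigma {Ω : Type*} (K : ℕ → Ω → ℕ) (n : ℕ) : MeasurableSpace Ω :=
  ⨆ j ∈ Finset.Icc 2 n, MeasurableSpace.comap (K j) ⊤

/-- `K` is the sequence of parent labels of a weighted recursive tree with weights `(w_n)_{n ≥ 1}`:
the parent of `u_{n+1}` is a vertex of `T_n`, and, conditionally on `T_n`, it is the
vertex labelled `k` with probability `w_k / W_n`. -/
structure IsWRT {Ω : Type*} [MeasurableSpace Ω] (P : Measure Ω) (w : ℕ → ℝ)
    (K : ℕ → Ω → ℕ) : Prop where
  measurable : ∀ n, 2 ≤ n → Measurable (K n)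
  parent_mem : ∀ n, 1 ≤ n → ∀ ω, K (n + 1) ω ∈ Finset.Icc 1 n
  condProb : ∀ n, 1 ≤ n → ∀ k ∈ Finset.Icc 1 n,
    P⟦{ω | K (n + 1) ω = k} | treeSigma K n⟧ =ᵐ[P] fun _ => w k / totalWeight w n

/-! ### The time change -/

/-- For a strictly increasing sequence `i` with `i 0 = 1` and `n ≥ 1`, this is `t_n`, the unique
`r ≥ 0` with `i_{r-1} + 1 ≤ n ≤ i_r`, where `i_{-1} = 0` (see `timeIndex_eq_iff`). -/
def timeIndex (i : ℕ → ℕ) (n : ℕ) : ℕ := sInf {r | n ≤ i r}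

theorem timeIndex_eq_iff {i : ℕ → ℕ} (hi : StrictMono i) {n : ℕ} (r : ℕ) :
    timeIndex i n = r ↔ n ≤ i r ∧ (1 ≤ r → i (r - 1) + 1 ≤ n) := by
  have hne : {r | n ≤ i r}.Nonempty := ⟨n, hi.id_le n⟩
  constructor
  · rintro rfl
    refine ⟨Nat.sInf_mem hne, fun h => ?_⟩
    by_contra hc
    have h2 : timeIndex i n ≤ timeIndex i n - 1 :=
      Nat.sInf_le (show n ≤ i (timeIndex i n - 1) by omega)
    omega
  · rintro ⟨h1, h2⟩
    refine le_antisymm (Nat.sInf_le h1) ?_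
    by_contra hc
    have h3 : n ≤ i (timeIndex i n) := Nat.sInf_mem hne
    have h4 : i (timeIndex i n) ≤ i (r - 1) := hi.monotone (by omega)
    have := h2 (by omega)
    omega

/-! ### The tilted random walk -/

/-- `p_j = e^{θ_{t_j}} (w_j / W_j) / (1 + (e^{θ_{t_j}} - 1) w_j / W_j)`. -/
def tiltedProb (w : ℕ → ℝ) (i : ℕ → ℕ) (θ : ℕ → ℝ) (j : ℕ) : ℝ :=
  (Real.exp (θ (timeIndex i j)) * (w j / totalWeight w j)) /
    (1 + (Real.exp (θ (timeIndex i j)) - 1) * (w j / totalWeight w j))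

theorem tiltedProb_mem_Icc {w : ℕ → ℝ} (hw : ∀ n, 1 ≤ n → 0 ≤ w n) (i : ℕ → ℕ) (θ : ℕ → ℝ)
    {j : ℕ} (hj : 1 ≤ j) : tiltedProb w i θ j ∈ Set.Icc (0 : ℝ) 1 := by
  have hW : w j ≤ totalWeight w j :=
    Finset.single_le_sum (f := w) (fun k hk => hw k (Finset.mem_Icc.1 hk).1)
      (Finset.mem_Icc.2 ⟨hj, le_rfl⟩)
  have hq0 : 0 ≤ w j / totalWeight w j := div_nonneg (hw j hj) ((hw j hj).trans hW)
  have hq1 : w j / totalWeight w j ≤ 1 := div_le_one_of_le₀ hW ((hw j hj).trans hW)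
  have he := mul_nonneg (Real.exp_pos (θ (timeIndex i j))).le hq0
  unfold tiltedProb
  exact ⟨div_nonneg he (by linarith), div_le_one_of_le₀ (by linarith) (by linarith)⟩

/-- The law of a sequence `(Y_j)` of independent Bernoulli(`p_j`) random variables. The projection
onto `[0, 1]` leaves `p_j` unchanged for `j ≥ 1`, by `tiltedProb_mem_Icc`; the coordinates `Y_0`
and `Y_1` are not used below. -/
def tiltedLaw (w : ℕ → ℝ) (i : ℕ → ℕ) (θ : ℕ → ℝ) : Measure (ℕ → ℕ) :=
  Measure.infinitePi fun j =>
    bernoulliMeasure 1 0 (Set.projIcc (0 : ℝ) 1 zero_le_one (tiltedProb w i θ j))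

/-- `S_r = ∑_{s=1}^r (X_s - 1)`, where `X_s = ∑_{j = i_{s-1}+1}^{min(i_s, n)} Y_j`. -/
def walk (i : ℕ → ℕ) (n : ℕ) (Y : ℕ → ℕ) (r : ℕ) : ℤ :=
  ∑ s ∈ Finset.Icc 1 r, ((∑ j ∈ Finset.Ioc (i (s - 1)) (min (i s) n), (Y j : ℤ)) - 1)

/-! ### The quantities `E(n)`, `δ₁(n)` and `δ₂(n)` -/

/-- `E(n)`: the expectation of
`exp (∑_{r=1}^{t_n-T(n)-1} (θ_{T(n)+r+1} - θ_{T(n)+r}) (S_{T(n)+r} - S_{T(n)}))`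
on the event that `S_{t_n} = S_{T(n)}` and `S_{T(n)+r} ≤ S_{T(n)}` for all `r < t_n - T(n)`. -/
def E (w : ℕ → ℝ) (i : ℕ → ℕ) (θ : ℕ → ℝ) (T : ℕ → ℕ) (n : ℕ) : ℝ :=
  ∫ Y, Set.indicator
    {Y : ℕ → ℕ | walk i n Y (timeIndex i n) = walk i n Y (T n) ∧
      ∀ r < timeIndex i n - T n, walk i n Y (T n + r) ≤ walk i n Y (T n)}
    (fun Y => Real.exp (∑ r ∈ Finset.Icc 1 (timeIndex i n - T n - 1),
      (θ (T n + r + 1) - θ (T n + r)) * ((walk i n Y (T n + r) - walk i n Y (T n) : ℤ) : ℝ)))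
    Y ∂(tiltedLaw w i θ)

/-- `δ₁(n) = ∑_{ℓ ≥ i_{T(n)}+1} e^{2θ_{t_ℓ}} w_ℓ² / W_ℓ²`, an element of `[0, ∞]`. -/
def delta₁ (w : ℕ → ℝ) (i : ℕ → ℕ) (θ : ℕ → ℝ) (T : ℕ → ℕ) (n : ℕ) : ℝ≥0∞ :=
  ∑' ℓ : {ℓ : ℕ // i (T n) + 1 ≤ ℓ},
    ENNReal.ofReal (Real.exp (2 * θ (timeIndex i ℓ)) * (w ℓ ^ 2 / totalWeight w ℓ ^ 2))

/-- `δ₂(n) = ∑_{ℓ ≥ i_{T(n)}+1} e^{2θ_{t_ℓ}} (w_ℓ² / W_ℓ²) exp (∑_{r=T(n)+1}^{t_ℓ-1} θ_r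
- ∑_{j=i_{T(n)}+1}^{i_{t_ℓ-1}} (e^{θ_{t_j}} - 1) w_j / W_j)`, an element of `[0, ∞]`. -/
def delta₂ (w : ℕ → ℝ) (i : ℕ → ℕ) (θ : ℕ → ℝ) (T : ℕ → ℕ) (n : ℕ) : ℝ≥0∞ :=
  ∑' ℓ : {ℓ : ℕ // i (T n) + 1 ≤ ℓ},
    ENNReal.ofReal (Real.exp (2 * θ (timeIndex i ℓ)) * (w ℓ ^ 2 / totalWeight w ℓ ^ 2) *
      Real.exp (∑ r ∈ Finset.Icc (T n + 1) (timeIndex i ℓ - 1), θ r -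
        ∑ j ∈ Finset.Icc (i (T n) + 1) (i (timeIndex i ℓ - 1)),
          (Real.exp (θ (timeIndex i j)) - 1) * (w j / totalWeight w j)))

end WRT

end

/-! The proof is a second moment argument. Let `Z` be the weighted proportion of vertices of
`T_{i_t}` whose ancestral line, restricted to labels in `(i_T, i_t]` with `T = T(i_t)`, has exactly
`t - T` elements, at most `r` of them being `≤ i_{T+r}` for every `r < t - T`. If `Z ≠ 0`, some
vertex has height at least `t - T`. The barrier keeps lines from gaining height early, which limits
what pairs of lines with a long common part add to the second moment.

First moment: the restricted line of a weight-sampled vertex contains each label `j` independently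
with probability `w_j / W_j` (`integral_vertexAvg`). Tilting by `θ` turns these into the
probabilities `p_j`, and summation by parts identifies the tilted expectation with `E`, so the mean
is `G * E` with an explicit `G > 0` (`subsetAvg_excursionIndicator`).

Second moment: sample two vertices by weight and split according to the largest label `l` common to
both lines. `integral_vertexAvg_sq_le` bounds the second moment by the squared mean plus a sum over
`l`. Since `θ` is non-decreasing, the barrier forces the labels of an excursion to carry enough
`θ`-mass, overall and from `l` on; this bounds the sum by `G ^ 2 * exp (δ₁ / 2) * δ₂`
(`sq_mul_subsetAvg_le`).

Chebyshev's inequality then gives `P(Z = 0) ≤ exp (δ₁ / 2) * δ₂ / E ^ 2`, which is summable in `t`.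
Borel-Cantelli yields the claim along `n = i_t`, and monotonicity of the height and of `T` extends
it to all `n`, at the cost of the final `-1`. -/

namespace WRT

/-! ### Averages over random subsets -/

/-- Expectation of `F s`, where the random subset `s` of `I` contains each `j ∈ I` independently
with probability `q j`. -/
noncomputable def subsetAvg (q : ℕ → ℝ) (I : Finset ℕ) (F : Finset ℕ → ℝ) : ℝ :=
  ∑ s ∈ I.powerset, (∏ j ∈ s, q j) * (∏ j ∈ I \ s, (1 - q j)) * F s

@[simp]
theorem subsetAvg_empty (q : ℕ → ℝ) (F : Finset ℕ → ℝ) : subsetAvg q ∅ F = F ∅ := by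
  simp [subsetAvg]

theorem subsetAvg_add (q : ℕ → ℝ) (I : Finset ℕ) (F G : Finset ℕ → ℝ) :
    subsetAvg q I (fun s => F s + G s) = subsetAvg q I F + subsetAvg q I G := by
  simp [subsetAvg, mul_add, Finset.sum_add_distrib]

theorem subsetAvg_const_mul (q : ℕ → ℝ) (I : Finset ℕ) (c : ℝ) (F : Finset ℕ → ℝ) :
    subsetAvg q I (fun s => c * F s) = c * subsetAvg q I F := by
  simp only [subsetAvg, Finset.mul_sum]
  exact Finset.sum_congr rfl fun s _ => by ring

theorem subsetAvg_const (q : ℕ → ℝ) (I : Finset ℕ) (c : ℝ) :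
    subsetAvg q I (fun _ => c) = c := by
  have h := Finset.prod_add q (fun j => 1 - q j) I
  simp only [add_sub_cancel, Finset.prod_const_one] at h
  rw [subsetAvg, ← Finset.sum_mul, ← h, one_mul]

/-- Condition on whether `a` is selected. This matches the arrival of a new vertex in the tree and
drives the inductions on `n` below. -/
theorem subsetAvg_insert (q : ℕ → ℝ) {I : Finset ℕ} {a : ℕ} (ha : a ∉ I)
    (F : Finset ℕ → ℝ) :
    subsetAvg q (insert a I) F =
      subsetAvg q I (fun s => (1 - q a) * F s + q a * F (insert a s)) := by
  rw [subsetAvg_add, subsetAvg_const_mul, subsetAvg_const_mul]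
  simp only [subsetAvg]
  rw [Finset.sum_powerset_insert ha, Finset.mul_sum, Finset.mul_sum]
  congr 1 <;> refine Finset.sum_congr rfl fun s hs => ?_
  · have has : a ∉ s := fun h => ha (Finset.mem_powerset.1 hs h)
    rw [Finset.insert_sdiff_of_notMem _ has, Finset.prod_insert (by simp [ha])]
    ring
  · have has : a ∉ s := fun h => ha (Finset.mem_powerset.1 hs h)
    rw [Finset.insert_sdiff_insert, Finset.sdiff_insert_of_notMem ha,
      Finset.prod_insert has]
    ring

theorem subsetAvg_mono {q : ℕ → ℝ} {I : Finset ℕ} (hq : ∀ j ∈ I, q j ∈ Set.Icc (0 : ℝ) 1)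
    {F G : Finset ℕ → ℝ} (h : ∀ s ⊆ I, F s ≤ G s) : subsetAvg q I F ≤ subsetAvg q I G := by
  refine Finset.sum_le_sum fun s hs => ?_
  rw [Finset.mem_powerset] at hs
  refine mul_le_mul_of_nonneg_left (h s hs) (mul_nonneg ?_ ?_)
  · exact Finset.prod_nonneg fun j hj => (hq j (hs hj)).1
  · exact Finset.prod_nonneg fun j hj => sub_nonneg.2 (hq j (Finset.mem_sdiff.1 hj).1).2

theorem subsetAvg_nonneg {q : ℕ → ℝ} {I : Finset ℕ} (hq : ∀ j ∈ I, q j ∈ Set.Icc (0 : ℝ) 1)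
    {F : Finset ℕ → ℝ} (h : ∀ s ⊆ I, 0 ≤ F s) : 0 ≤ subsetAvg q I F := by
  rw [← subsetAvg_const q I 0]
  exact subsetAvg_mono hq h

theorem subsetAvg_le_of_le {q : ℕ → ℝ} {I : Finset ℕ} (hq : ∀ j ∈ I, q j ∈ Set.Icc (0 : ℝ) 1)
    {F : Finset ℕ → ℝ} {c : ℝ} (h : ∀ s ⊆ I, F s ≤ c) : subsetAvg q I F ≤ c := by
  rw [← subsetAvg_const q I c]
  exact subsetAvg_mono hq h

/-- Exponential change of measure for a random subset. -/
theorem subsetAvg_tilt {q p ψ : ℕ → ℝ} {I : Finset ℕ}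
    (hpos : ∀ j ∈ I, 0 < 1 + (Real.exp (ψ j) - 1) * q j)
    (hp : ∀ j ∈ I, p j = Real.exp (ψ j) * q j / (1 + (Real.exp (ψ j) - 1) * q j))
    (F : Finset ℕ → ℝ) :
    subsetAvg q I F = (∏ j ∈ I, (1 + (Real.exp (ψ j) - 1) * q j)) *
      subsetAvg p I (fun s => Real.exp (-∑ j ∈ s, ψ j) * F s) := by
  simp only [subsetAvg, Finset.mul_sum]
  refine Finset.sum_congr rfl fun s hs => ?_
  rw [Finset.mem_powerset] at hs
  -- With `M_j` the normalization, `q_j = M_j p_j e^{-ψ_j}` and `1 - q_j = M_j (1 - p_j)`: only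
  -- selected labels pay the factor `e^{-ψ_j}`.
  have h1 : ∏ j ∈ s, q j = (∏ j ∈ s, (1 + (Real.exp (ψ j) - 1) * q j)) * (∏ j ∈ s, p j) *
      Real.exp (-∑ j ∈ s, ψ j) := by
    rw [← Finset.sum_neg_distrib, Real.exp_sum, ← Finset.prod_mul_distrib,
      ← Finset.prod_mul_distrib]
    refine Finset.prod_congr rfl fun j hj => ?_
    have := (hpos j (hs hj)).ne'
    rw [hp j (hs hj), Real.exp_neg, mul_div_assoc', mul_div_cancel_left₀ _ this]
    field_simp
  have h2 : ∏ j ∈ I \ s, (1 - q j) =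
      (∏ j ∈ I \ s, (1 + (Real.exp (ψ j) - 1) * q j)) * ∏ j ∈ I \ s, (1 - p j) := by
    rw [← Finset.prod_mul_distrib]
    refine Finset.prod_congr rfl fun j hj => ?_
    have hj := (Finset.mem_sdiff.1 hj).1
    have := (hpos j hj).ne'
    rw [hp j hj, mul_sub, mul_div_assoc', mul_div_cancel_left₀ _ this]
    ring
  rw [h1, h2, ← Finset.prod_sdiff hs]
  ring

/-- The coordinates in `I` at which a sequence of independent Bernoulli variables equals `1` form
a random subset of `I` in the sense of `subsetAvg`. -/
theorem integral_filter_infinitePi (p : ℕ → unitInterval) (I : Finset ℕ)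
    (φ : Finset ℕ → ℝ) :
    ∫ Y, φ (I.filter fun j => Y j = 1)
      ∂(Measure.infinitePi fun j => bernoulliMeasure (1 : ℕ) 0 (p j)) =
      subsetAvg (fun j => (p j : ℝ)) I φ := by
  set μ := Measure.infinitePi fun j => bernoulliMeasure (1 : ℕ) 0 (p j)
  have hset : ∀ s ⊆ I, {Y : ℕ → ℕ | I.filter (fun j => Y j = 1) = s} =
      Set.pi (I : Set ℕ) (fun j => if j ∈ s then {1} else {1}ᶜ) := by
    intro s hs
    ext Y
    simp only [Set.mem_ofPred_eq, Set.mem_pi, Finset.mem_coe, Finset.ext_iff, Finset.mem_filter]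
    constructor
    · intro h j hj
      by_cases hjs : j ∈ s
      · simpa [hjs] using ((h j).2 hjs).2
      · simpa [hjs] using fun h1 => hjs ((h j).1 ⟨hj, h1⟩)
    · intro h j
      constructor
      · rintro ⟨hj, h1⟩
        by_contra hjs
        have := h j hj
        simp [hjs, h1] at this
      · intro hjs
        have := h j (hs hjs)
        simp only [hjs, if_true, Set.mem_singleton_iff] at this
        exact ⟨hs hjs, this⟩
  have hmeas : ∀ s ⊆ I, MeasurableSet {Y : ℕ → ℕ | I.filter (fun j => Y j = 1) = s} := by
    intro s hs
    rw [hset s hs]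
    exact MeasurableSet.pi I.countable_toSet fun j _ => MeasurableSet.of_discrete
  have hμ : ∀ s ⊆ I, μ.real {Y : ℕ → ℕ | I.filter (fun j => Y j = 1) = s} =
      (∏ j ∈ s, (p j : ℝ)) * ∏ j ∈ I \ s, (1 - (p j : ℝ)) := by
    intro s hs
    rw [hset s hs, measureReal_def, Measure.infinitePi_pi _ fun j _ => MeasurableSet.of_discrete,
      ENNReal.toReal_prod, ← Finset.prod_sdiff hs, mul_comm]
    congr 1 <;> refine Finset.prod_congr rfl fun j hj => ?_
    · rw [if_pos hj, ← measureReal_def]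
      exact bernoulliMeasure_real_apply_of_mem_of_notMem _ MeasurableSet.of_discrete (by simp)
        (by simp)
    · rw [if_neg (Finset.mem_sdiff.1 hj).2, ← measureReal_def]
      exact bernoulliMeasure_real_apply_of_notMem_of_mem _ MeasurableSet.of_discrete (by simp)
        (by simp)
  have hsum : ∀ Y : ℕ → ℕ, φ (I.filter fun j => Y j = 1) = ∑ s ∈ I.powerset,
      Set.indicator {Y : ℕ → ℕ | I.filter (fun j => Y j = 1) = s} (fun _ => φ s) Y := by
    intro Y
    rw [Finset.sum_eq_single (I.filter fun j => Y j = 1)]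
    · simp
    · intro s _ hne
      exact Set.indicator_of_notMem (fun h => hne h.symm) _
    · intro h
      exact absurd (Finset.mem_powerset.2 (Finset.filter_subset _ _)) h
  simp_rw [hsum]
  rw [integral_finsetSum _ fun s hs => (integrable_const _).indicator
    (hmeas s (Finset.mem_powerset.1 hs)), subsetAvg]
  refine Finset.sum_congr rfl fun s hs => ?_
  rw [integral_indicator_const _ (hmeas s (Finset.mem_powerset.1 hs)),
    hμ s (Finset.mem_powerset.1 hs), smul_eq_mul]

theorem ae_infinitePi_bernoulli (p : ℕ → unitInterval) :
    ∀ᵐ Y ∂(Measure.infinitePi fun j => bernoulliMeasure (1 : ℕ) 0 (p j)),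
      ∀ j, Y j = 0 ∨ Y j = 1 := by
  refine ae_all_iff.2 fun j => ?_
  refine (measurePreserving_eval_infinitePi
    (fun j => bernoulliMeasure (1 : ℕ) 0 (p j)) j).quasiMeasurePreserving.ae
    (p := fun y => y = 0 ∨ y = 1) ?_
  rw [ae_iff]
  exact bernoulliMeasure_apply_of_notMem_of_notMem _ MeasurableSet.of_discrete (by simp)
    (by simp)

/-! ### Ancestral lines -/

/-- Labels of the vertices other than the root on the path from the root to the vertex
labelled `k`. -/
def ancestors (K : ℕ → ℕ) (k : ℕ) : Finset ℕ :=
  if _h : 1 ≤ K k ∧ K k < k then insert k (ancestors K (K k)) else ∅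
termination_by k
decreasing_by exact _h.2

theorem ancestors_of_mem {K : ℕ → ℕ} {k : ℕ} (h : 1 ≤ K k ∧ K k < k) :
    ancestors K k = insert k (ancestors K (K k)) := by
  rw [ancestors, dif_pos h]

theorem ancestors_subset_Ioc (K : ℕ → ℕ) (k : ℕ) : ancestors K k ⊆ Finset.Ioc 1 k := by
  induction k using Nat.strong_induction_on with
  | _ k ih =>
    rw [ancestors]
    split_ifs with h
    · refine Finset.insert_subset (Finset.mem_Ioc.2 ⟨by omega, le_rfl⟩) ((ih _ h.2).trans ?_)
      exact Finset.Ioc_subset_Ioc_right h.2.le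
    · simp

theorem card_ancestors (K : ℕ → ℕ) (k : ℕ) : (ancestors K k).card = vertexHeight K k := by
  induction k using Nat.strong_induction_on with
  | _ k ih =>
    rw [ancestors, vertexHeight]
    split_ifs with h
    · rw [Finset.card_insert_of_notMem, ih _ h.2]
      intro hk
      have := (Finset.mem_Ioc.1 (ancestors_subset_Ioc K _ hk)).2
      omega
    · simp

theorem ancestors_one (K : ℕ → ℕ) : ancestors K 1 = ∅ := by
  have := ancestors_subset_Ioc K 1
  simpa using this

/-! ### Moments of weighted sums over vertices -/

theorem totalWeight_succ (w : ℕ → ℝ) (n : ℕ) :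
    totalWeight w (n + 1) = totalWeight w n + w (n + 1) := by
  simp [totalWeight, Finset.sum_Icc_succ_top]

theorem totalWeight_pos {w : ℕ → ℝ} (hw : ∀ n, 1 ≤ n → 0 ≤ w n) (hw1 : 0 < w 1) {n : ℕ}
    (hn : 1 ≤ n) : 0 < totalWeight w n := by
  refine Finset.sum_pos' (fun k hk => hw k (Finset.mem_Icc.1 hk).1) ⟨1, ?_, hw1⟩
  simpa using hn

theorem weight_ratio_mem_Icc {w : ℕ → ℝ} (hw : ∀ n, 1 ≤ n → 0 ≤ w n) {j : ℕ} (hj : 1 ≤ j) :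
    w j / totalWeight w j ∈ Set.Icc (0 : ℝ) 1 := by
  have hW : w j ≤ totalWeight w j :=
    Finset.single_le_sum (f := w) (fun k hk => hw k (Finset.mem_Icc.1 hk).1)
      (Finset.mem_Icc.2 ⟨hj, le_rfl⟩)
  exact ⟨div_nonneg (hw j hj) ((hw j hj).trans hW), div_le_one_of_le₀ hW ((hw j hj).trans hW)⟩

/-- Average of `f (ancestors K k)` over the vertices `k` of `T_n`, chosen with probability
proportional to its weight. -/
noncomputable def vertexAvg (w : ℕ → ℝ) (K : ℕ → ℕ) (n : ℕ) (f : Finset ℕ → ℝ) : ℝ :=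
  ∑ k ∈ Finset.Icc 1 n, w k / totalWeight w n * f (ancestors K k)

theorem vertexAvg_congr {w : ℕ → ℝ} {K : ℕ → ℕ} {n : ℕ} {f g : Finset ℕ → ℝ}
    (h : ∀ s ⊆ Finset.Ioc 1 n, f s = g s) : vertexAvg w K n f = vertexAvg w K n g := by
  refine Finset.sum_congr rfl fun k hk => ?_
  rw [h _ ((ancestors_subset_Ioc K k).trans
    (Finset.Ioc_subset_Ioc_right (Finset.mem_Icc.1 hk).2))]

theorem vertexAvg_const {w : ℕ → ℝ} {n : ℕ} (hW : totalWeight w n ≠ 0) (K : ℕ → ℕ) (c : ℝ) :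
    vertexAvg w K n (fun _ => c) = c := by
  rw [vertexAvg, ← Finset.sum_mul, ← Finset.sum_div]
  change totalWeight w n / totalWeight w n * c = c
  rw [div_self hW, one_mul]

theorem vertexAvg_lin (w : ℕ → ℝ) (K : ℕ → ℕ) (n : ℕ) (a b : ℝ) (f g : Finset ℕ → ℝ) :
    vertexAvg w K n (fun s => a * f s + b * g s) =
      a * vertexAvg w K n f + b * vertexAvg w K n g := by
  simp only [vertexAvg, Finset.mul_sum, ← Finset.sum_add_distrib]
  exact Finset.sum_congr rfl fun k _ => by ring

/-- Since `W_n / W_{n+1} = 1 - w_{n+1} / W_{n+1}`, the old vertices keep their relative weights, and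
the line of the new vertex extends that of its parent. -/
theorem vertexAvg_succ {w : ℕ → ℝ} (hw : ∀ n, 1 ≤ n → 0 ≤ w n) (hw1 : 0 < w 1) {K : ℕ → ℕ}
    {n : ℕ} (hn : 1 ≤ n) (hK : K (n + 1) ∈ Finset.Icc 1 n) (f : Finset ℕ → ℝ) :
    vertexAvg w K (n + 1) f =
      (1 - w (n + 1) / totalWeight w (n + 1)) * vertexAvg w K n f +
        w (n + 1) / totalWeight w (n + 1) * f (insert (n + 1) (ancestors K (K (n + 1)))) := by
  have h1 := totalWeight_pos hw hw1 hn
  have h2 := totalWeight_pos hw hw1 (n := n + 1) (by omega)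
  have h3 := totalWeight_succ w n
  rw [Finset.mem_Icc] at hK
  rw [vertexAvg, Finset.sum_Icc_succ_top (by omega), vertexAvg, Finset.mul_sum,
    ancestors_of_mem (k := n + 1) (by omega)]
  congr 1
  refine Finset.sum_congr rfl fun k _ => ?_
  rw [← mul_assoc]
  congr 1
  have h4 : 1 - w (n + 1) / totalWeight w (n + 1) = totalWeight w n / totalWeight w (n + 1) := by
    rw [h3] at h2 ⊢
    field_simp
    ring
  rw [h4]
  field_simp

/-! ### Conditioning on the tree -/

theorem measurable_parent_treeSigma {Ω : Type*} (K : ℕ → Ω → ℕ) {n j : ℕ} (hj : j ∈ Finset.Icc 2 n) :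
    Measurable[treeSigma K n] (K j) :=
  measurable_iff_comap_le.2 (le_iSup₂_of_le j hj le_rfl)

section

variable {Ω : Type*} [mΩ : MeasurableSpace Ω] {P : Measure Ω}
  {w : ℕ → ℝ} {K : ℕ → Ω → ℕ}

theorem treeSigma_le (hK : IsWRT P w K) (n : ℕ) : treeSigma K n ≤ mΩ := by
  refine iSup₂_le fun j hj => ?_
  exact measurable_iff_comap_le.1 (hK.measurable j (Finset.mem_Icc.1 hj).1)

/-- Splitting over the value of the parent replaces a random index by deterministic ones, as needed
for measurability and for conditioning. -/
theorem ancestors_eq_sum (hK : IsWRT P w K) {k : ℕ} (hk : 2 ≤ k) (f : Finset ℕ → ℝ) (ω : Ω) :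
    f (ancestors (fun m => K m ω) (K k ω)) = ∑ j ∈ Finset.Icc 1 (k - 1),
      Set.indicator {ω | K k ω = j} (fun _ => (1 : ℝ)) ω *
        f (ancestors (fun m => K m ω) j) := by
  have hmem := hK.parent_mem (k - 1) (by omega) ω
  rw [Nat.sub_add_cancel (by omega)] at hmem
  rw [Finset.sum_eq_single_of_mem _ hmem]
  · simp
  · intro j _ hj
    rw [Set.indicator_of_notMem (fun h => hj h.symm), zero_mul]

theorem measurable_ancestors (hK : IsWRT P w K) {n k : ℕ} (hk : k ∈ Finset.Icc 1 n)
    (f : Finset ℕ → ℝ) :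
    Measurable[treeSigma K n] fun ω => f (ancestors (fun m => K m ω) k) := by
  induction k using Nat.strong_induction_on generalizing f with
  | _ k ih =>
    rw [Finset.mem_Icc] at hk
    rcases Nat.eq_or_lt_of_le hk.1 with h1 | h1
    · simp only [← h1, ancestors_one]
      exact measurable_const
    · have hf : (fun ω => f (ancestors (fun m => K m ω) k)) = fun ω =>
          ∑ j ∈ Finset.Icc 1 (k - 1), Set.indicator {ω | K k ω = j} (fun _ => (1 : ℝ)) ω *
            f (insert k (ancestors (fun m => K m ω) j)) := by
        funext ω
        have hmem := hK.parent_mem (k - 1) (by omega) ω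
        rw [Nat.sub_add_cancel (by omega), Finset.mem_Icc] at hmem
        rw [ancestors_of_mem (k := k) (by omega)]
        exact ancestors_eq_sum hK h1 (fun s => f (insert k s)) ω
      rw [hf]
      refine Finset.measurable_fun_sum _ fun j hj => ?_
      rw [Finset.mem_Icc] at hj
      refine Measurable.mul ?_ (ih j (by omega) (Finset.mem_Icc.2 (by omega)) fun s =>
        f (insert k s))
      refine Measurable.indicator measurable_const ?_
      exact measurable_parent_treeSigma K (Finset.mem_Icc.2 ⟨h1, hk.2⟩)
        (MeasurableSet.singleton j)

theorem measurable_vertexAvg (hK : IsWRT P w K) (n : ℕ) (f : Finset ℕ → ℝ) :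
    Measurable[treeSigma K n] fun ω => vertexAvg w (fun m => K m ω) n f :=
  Finset.measurable_fun_sum _ fun _ hk => (measurable_ancestors hK hk f).const_mul _

/-- The lines of vertices up to `n` take finitely many values, so every function of them is bounded,
uniformly in the tree. All integrability below rests on this. -/
theorem exists_abs_ancestors_le (f : Finset ℕ → ℝ) (n : ℕ) :
    ∃ C, ∀ K : ℕ → ℕ, ∀ k ≤ n, |f (ancestors K k)| ≤ C := by
  refine ⟨∑ s ∈ (Finset.Ioc 1 n).powerset, |f s|, fun K k hk => ?_⟩
  refine Finset.single_le_sum (f := fun s => |f s|) (fun _ _ => abs_nonneg _) ?_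
  exact Finset.mem_powerset.2 ((ancestors_subset_Ioc K k).trans
    (Finset.Ioc_subset_Ioc_right hk))

theorem exists_abs_vertexAvg_le (w : ℕ → ℝ) (f : Finset ℕ → ℝ) (n : ℕ) :
    ∃ C, ∀ K : ℕ → ℕ, |vertexAvg w K n f| ≤ C := by
  obtain ⟨C, hC⟩ := exists_abs_ancestors_le f n
  refine ⟨∑ k ∈ Finset.Icc 1 n, |w k / totalWeight w n| * C, fun K => ?_⟩
  refine (Finset.abs_sum_le_sum_abs _ _).trans (Finset.sum_le_sum fun k hk => ?_)
  rw [abs_mul]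
  exact mul_le_mul_of_nonneg_left (hC K k (Finset.mem_Icc.1 hk).2) (abs_nonneg _)

theorem integrable_mul_of_measurable_of_bound {f g : Ω → ℝ} (hf : Measurable f)
    (hfb : ∃ C, ∀ ω, |f ω| ≤ C) (hg : Integrable g P) : Integrable (fun ω => f ω * g ω) P := by
  obtain ⟨C, hC⟩ := hfb
  exact hg.bdd_mul hf.aestronglyMeasurable (ae_of_all _ hC)

theorem integral_const_mul_add₃ {f g h : Ω → ℝ} (hf : Integrable f P) (hg : Integrable g P)
    (hh : Integrable h P) (a b c : ℝ) :
    ∫ ω, (a * f ω + b * g ω + c * h ω) ∂P =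
      a * ∫ ω, f ω ∂P + b * ∫ ω, g ω ∂P + c * ∫ ω, h ω ∂P := by
  have hfg : Integrable (fun ω => a * f ω + b * g ω) P := (hf.const_mul a).add (hg.const_mul b)
  rw [integral_add hfg (hh.const_mul c), integral_add (hf.const_mul a) (hg.const_mul b),
    integral_const_mul, integral_const_mul, integral_const_mul]

variable [IsProbabilityMeasure P]

theorem integrable_of_measurable_of_bound {f : Ω → ℝ} (hf : Measurable f)
    (hfb : ∃ C, ∀ ω, |f ω| ≤ C) : Integrable f P := by
  simpa using integrable_mul_of_measurable_of_bound (P := P) hf hfb (integrable_const (1 : ℝ))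

theorem integrable_vertexAvg_mul (hK : IsWRT P w K) (n : ℕ) (f g : Finset ℕ → ℝ) :
    Integrable (fun ω => vertexAvg w (fun m => K m ω) n f *
      vertexAvg w (fun m => K m ω) n g) P := by
  obtain ⟨C, hC⟩ := exists_abs_vertexAvg_le w f n
  obtain ⟨D, hD⟩ := exists_abs_vertexAvg_le w g n
  exact integrable_mul_of_measurable_of_bound
    ((measurable_vertexAvg hK n f).mono (treeSigma_le hK n) le_rfl) ⟨C, fun _ => hC _⟩
    (integrable_of_measurable_of_bound
      ((measurable_vertexAvg hK n g).mono (treeSigma_le hK n) le_rfl) ⟨D, fun _ => hD _⟩)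

theorem integrable_vertexAvg (hK : IsWRT P w K) (n : ℕ) (f : Finset ℕ → ℝ) :
    Integrable (fun ω => vertexAvg w (fun m => K m ω) n f) P := by
  obtain ⟨C, hC⟩ := exists_abs_vertexAvg_le w f n
  exact integrable_of_measurable_of_bound
    ((measurable_vertexAvg hK n f).mono (treeSigma_le hK n) le_rfl) ⟨C, fun _ => hC _⟩

/-- Pull the `T_n`-measurable factor out of the conditional expectation. -/
theorem integral_indicator_parent_mul (hK : IsWRT P w K) {n k : ℕ} (hn : 1 ≤ n)
    (hk : k ∈ Finset.Icc 1 n) {H : Ω → ℝ} (hH : Measurable[treeSigma K n] H)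
    (hHb : ∃ C, ∀ ω, |H ω| ≤ C) :
    ∫ ω, H ω * Set.indicator {ω | K (n + 1) ω = k} (fun _ => (1 : ℝ)) ω ∂P =
      w k / totalWeight w n * ∫ ω, H ω ∂P := by
  have hle := treeSigma_le hK n
  have hset : MeasurableSet {ω | K (n + 1) ω = k} :=
    hK.measurable (n + 1) (by omega) (MeasurableSet.singleton k)
  have hind : Integrable (Set.indicator {ω | K (n + 1) ω = k} (fun _ => (1 : ℝ))) P :=
    (integrable_const _).indicator hset
  have hpull := condExp_mul_of_stronglyMeasurable_left (m := treeSigma K n) (μ := P)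
    hH.stronglyMeasurable (integrable_mul_of_measurable_of_bound (hH.mono hle le_rfl) hHb hind)
    hind
  rw [← integral_const_mul]
  refine (integral_condExp hle).symm.trans (integral_congr_ae ?_)
  filter_upwards [hpull, hK.condProb n hn k hk] with ω h1 h2
  refine h1.trans ?_
  rw [Pi.mul_apply, h2, mul_comm]

/-- Conditionally on `T_n`, the parent of `u_{n+1}` is a vertex of `T_n` chosen with probability
proportional to its weight. -/
theorem integral_mul_ancestors_parent (hK : IsWRT P w K) {n : ℕ} (hn : 1 ≤ n)
    (f : Finset ℕ → ℝ) {H : Ω → ℝ} (hH : Measurable[treeSigma K n] H)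
    (hHb : ∃ C, ∀ ω, |H ω| ≤ C) :
    ∫ ω, H ω * f (ancestors (fun m => K m ω) (K (n + 1) ω)) ∂P =
      ∫ ω, H ω * vertexAvg w (fun m => K m ω) n f ∂P := by
  have hle := treeSigma_le hK n
  obtain ⟨C, hC⟩ := hHb
  obtain ⟨D, hD⟩ := exists_abs_ancestors_le f n
  have hbound : ∀ k ∈ Finset.Icc 1 n, ∃ B, ∀ ω, |H ω * f (ancestors (fun m => K m ω) k)| ≤ B := by
    intro k hk
    refine ⟨C * D, fun ω => ?_⟩
    rw [abs_mul]
    exact mul_le_mul (hC ω) (hD _ k (Finset.mem_Icc.1 hk).2) (abs_nonneg _)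
      ((abs_nonneg _).trans (hC ω))
  have hmeas : ∀ k ∈ Finset.Icc 1 n,
      Measurable[treeSigma K n] fun ω => H ω * f (ancestors (fun m => K m ω) k) :=
    fun k hk => hH.mul (measurable_ancestors hK hk f)
  have hlhs : ∀ ω, H ω * f (ancestors (fun m => K m ω) (K (n + 1) ω)) =
      ∑ k ∈ Finset.Icc 1 n, H ω * f (ancestors (fun m => K m ω) k) *
        Set.indicator {ω | K (n + 1) ω = k} (fun _ => (1 : ℝ)) ω := by
    intro ω
    rw [ancestors_eq_sum hK (k := n + 1) (by omega) f, Finset.mul_sum, Nat.add_sub_cancel]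
    exact Finset.sum_congr rfl fun k _ => by ring
  have hrhs : ∀ ω, H ω * vertexAvg w (fun m => K m ω) n f =
      ∑ k ∈ Finset.Icc 1 n, w k / totalWeight w n *
        (H ω * f (ancestors (fun m => K m ω) k)) := by
    intro ω
    rw [vertexAvg, Finset.mul_sum]
    exact Finset.sum_congr rfl fun k _ => by ring
  simp_rw [hlhs, hrhs]
  rw [integral_finsetSum, integral_finsetSum]
  · refine Finset.sum_congr rfl fun k hk => ?_
    rw [integral_indicator_parent_mul hK hn hk (hmeas k hk) (hbound k hk), integral_const_mul]
  · exact fun k hk => (integrable_of_measurable_of_bound ((hmeas k hk).mono hle le_rfl)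
      (hbound k hk)).const_mul _
  · exact fun k hk => integrable_mul_of_measurable_of_bound ((hmeas k hk).mono hle le_rfl)
      (hbound k hk) ((integrable_const _).indicator
        (hK.measurable (n + 1) (by omega) (MeasurableSet.singleton k)))

theorem integrable_mul_ancestors_parent (hK : IsWRT P w K) {n : ℕ} (hn : 1 ≤ n)
    (f : Finset ℕ → ℝ) {H : Ω → ℝ} (hH : Measurable[treeSigma K n] H)
    (hHb : ∃ C, ∀ ω, |H ω| ≤ C) :
    Integrable (fun ω => H ω * f (ancestors (fun m => K m ω) (K (n + 1) ω))) P := by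
  have hle := treeSigma_le hK n
  refine integrable_mul_of_measurable_of_bound (hH.mono hle le_rfl) hHb ?_
  obtain ⟨D, hD⟩ := exists_abs_ancestors_le f n
  refine integrable_of_measurable_of_bound ?_ ⟨D, fun ω => hD _ _
    (Finset.mem_Icc.1 (hK.parent_mem n hn ω)).2⟩
  have hlhs := ancestors_eq_sum hK (k := n + 1) (by omega) f
  simp_rw [hlhs]
  refine Finset.measurable_fun_sum _ fun j hj => Measurable.mul ?_
    ((measurable_ancestors hK hj f).mono hle le_rfl)
  exact measurable_const.indicator
    (hK.measurable (n + 1) (by omega) (MeasurableSet.singleton j))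

theorem integral_vertexAvg_succ (hw : ∀ n, 1 ≤ n → 0 ≤ w n) (hw1 : 0 < w 1)
    (hK : IsWRT P w K) {n : ℕ} (hn : 1 ≤ n) (f : Finset ℕ → ℝ) :
    ∫ ω, vertexAvg w (fun m => K m ω) (n + 1) f ∂P =
      ∫ ω, vertexAvg w (fun m => K m ω) n (fun s =>
        (1 - w (n + 1) / totalWeight w (n + 1)) * f s +
          w (n + 1) / totalWeight w (n + 1) * f (insert (n + 1) s)) ∂P := by
  have h1 : ∃ C, ∀ ω : Ω, |(fun _ => (1 : ℝ)) ω| ≤ C := ⟨1, by simp⟩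
  have hpar := integral_mul_ancestors_parent hK hn (fun s => f (insert (n + 1) s))
    (H := fun _ => 1) measurable_const h1
  have hint := integrable_mul_ancestors_parent hK hn (fun s => f (insert (n + 1) s))
    (H := fun _ => 1) measurable_const h1
  simp only [one_mul] at hpar hint
  have hlhs : ∀ ω, vertexAvg w (fun m => K m ω) (n + 1) f = _ :=
    fun ω => vertexAvg_succ hw hw1 hn (hK.parent_mem n hn ω) f
  simp_rw [hlhs, vertexAvg_lin]
  rw [integral_add ((integrable_vertexAvg hK n f).const_mul _) (hint.const_mul _),
    integral_add ((integrable_vertexAvg hK n f).const_mul _)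
      ((integrable_vertexAvg hK n _).const_mul _), integral_const_mul, integral_const_mul,
    integral_const_mul, hpar]

/-- Expand the square of the recursion for `vertexAvg`. Given `T_n`, the cross term averages to the
one obtained from a square of averages. The two sides differ only in the `q ^ 2` term, where an
average of squares replaces a squared average; the latter is non-negative and is dropped. -/
theorem integral_vertexAvg_sq_succ_le (hw : ∀ n, 1 ≤ n → 0 ≤ w n) (hw1 : 0 < w 1)
    (hK : IsWRT P w K) {n : ℕ} (hn : 1 ≤ n) (f : Finset ℕ → ℝ) :
    ∫ ω, vertexAvg w (fun m => K m ω) (n + 1) f ^ 2 ∂P ≤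
      ∫ ω, vertexAvg w (fun m => K m ω) n (fun s =>
        (1 - w (n + 1) / totalWeight w (n + 1)) * f s +
          w (n + 1) / totalWeight w (n + 1) * f (insert (n + 1) s)) ^ 2 ∂P +
      (w (n + 1) / totalWeight w (n + 1)) ^ 2 *
        ∫ ω, vertexAvg w (fun m => K m ω) n (fun s => f (insert (n + 1) s) ^ 2) ∂P := by
  set q := w (n + 1) / totalWeight w (n + 1)
  set g : Finset ℕ → ℝ := fun s => f (insert (n + 1) s)
  have h1 : ∃ C, ∀ ω : Ω, |(fun _ => (1 : ℝ)) ω| ≤ C := ⟨1, by simp⟩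
  have hb : ∃ C, ∀ ω : Ω, |vertexAvg w (fun m => K m ω) n f| ≤ C :=
    (exists_abs_vertexAvg_le w f n).imp fun C hC ω => hC _
  have hpar := integral_mul_ancestors_parent hK hn g (measurable_vertexAvg hK n f) hb
  have hint := integrable_mul_ancestors_parent hK hn g (measurable_vertexAvg hK n f) hb
  have hpar2 := integral_mul_ancestors_parent hK hn (fun s => g s ^ 2)
    (H := fun _ => 1) measurable_const h1
  have hint2 := integrable_mul_ancestors_parent hK hn (fun s => g s ^ 2)
    (H := fun _ => 1) measurable_const h1
  simp only [one_mul] at hpar2 hint2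
  have hff := integrable_vertexAvg_mul hK n f f
  have hfg := integrable_vertexAvg_mul hK n f g
  have hgg := integrable_vertexAvg_mul hK n g g
  have hlhs : ∀ ω, vertexAvg w (fun m => K m ω) (n + 1) f ^ 2 =
      (1 - q) ^ 2 * (vertexAvg w (fun m => K m ω) n f * vertexAvg w (fun m => K m ω) n f) +
      (2 * q * (1 - q)) * (vertexAvg w (fun m => K m ω) n f *
        g (ancestors (fun m => K m ω) (K (n + 1) ω))) +
      q ^ 2 * g (ancestors (fun m => K m ω) (K (n + 1) ω)) ^ 2 := by
    intro ω
    rw [vertexAvg_succ hw hw1 hn (hK.parent_mem n hn ω) f]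
    ring
  have hrhs : ∀ ω, vertexAvg w (fun m => K m ω) n (fun s => (1 - q) * f s + q * g s) ^ 2 =
      (1 - q) ^ 2 * (vertexAvg w (fun m => K m ω) n f * vertexAvg w (fun m => K m ω) n f) +
      (2 * q * (1 - q)) * (vertexAvg w (fun m => K m ω) n f * vertexAvg w (fun m => K m ω) n g) +
      q ^ 2 * (vertexAvg w (fun m => K m ω) n g * vertexAvg w (fun m => K m ω) n g) := by
    intro ω
    rw [vertexAvg_lin]
    ring
  rw [integral_congr_ae (ae_of_all P hlhs), integral_congr_ae (ae_of_all P hrhs)]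
  rw [integral_const_mul_add₃ hff hint hint2, integral_const_mul_add₃ hff hfg hgg, hpar, hpar2]
  have : 0 ≤ q ^ 2 * ∫ ω, vertexAvg w (fun m => K m ω) n g * vertexAvg w (fun m => K m ω) n g ∂P :=
    mul_nonneg (sq_nonneg _) (integral_nonneg fun ω => mul_self_nonneg _)
  linarith

/-- The restriction to `(m, n]` of the ancestral line of a random vertex of `T_n` contains each
label `j` independently with probability `w_j / W_j`. -/
theorem integral_vertexAvg (hw : ∀ n, 1 ≤ n → 0 ≤ w n) (hw1 : 0 < w 1)
    (hK : IsWRT P w K) {m n : ℕ} (hm : 1 ≤ m) (hmn : m ≤ n) (f : Finset ℕ → ℝ) :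
    ∫ ω, vertexAvg w (fun k => K k ω) n (fun s => f (s ∩ Finset.Ioc m n)) ∂P =
      subsetAvg (fun j => w j / totalWeight w j) (Finset.Ioc m n) f := by
  induction n, hmn using Nat.le_induction generalizing f with
  | base =>
    simp [vertexAvg_const (totalWeight_pos hw hw1 hm).ne']
  | succ n hmn ih =>
    rw [integral_vertexAvg_succ hw hw1 hK (hm.trans hmn), ← Finset.insert_Ioc_right_eq_Ioc_add_one hmn,
      subsetAvg_insert _ (by simp), ← ih]
    refine integral_congr_ae (ae_of_all _ fun ω => vertexAvg_congr fun s hs => ?_)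
    have hns : n + 1 ∉ s := fun h => by simpa using hs h
    rw [Finset.inter_insert_of_notMem hns, Finset.insert_inter_distrib]

/-- Iterating the one-step bound leaves one diagonal term per label. Here `l` plays the role of the
last common label of two sampled lines: `a` is their shared part below `l`, and the square comes
from two independent continuations above `l`. The squared mean accounts for pairs with no common
label in `(m, n]`. -/
theorem integral_vertexAvg_sq_le (hw : ∀ n, 1 ≤ n → 0 ≤ w n) (hw1 : 0 < w 1)
    (hK : IsWRT P w K) {m n : ℕ} (hm : 1 ≤ m) (hmn : m ≤ n) (f : Finset ℕ → ℝ) :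
    ∫ ω, vertexAvg w (fun k => K k ω) n (fun s => f (s ∩ Finset.Ioc m n)) ^ 2 ∂P ≤
      subsetAvg (fun j => w j / totalWeight w j) (Finset.Ioc m n) f ^ 2 +
      ∑ l ∈ Finset.Ioc m n, (w l / totalWeight w l) ^ 2 *
        subsetAvg (fun j => w j / totalWeight w j) (Finset.Ioc m (l - 1)) (fun a =>
          subsetAvg (fun j => w j / totalWeight w j) (Finset.Ioc l n)
            (fun s => f (insert l a ∪ s)) ^ 2) := by
  induction n, hmn using Nat.le_induction generalizing f with
  | base =>
    simp [vertexAvg_const (totalWeight_pos hw hw1 hm).ne']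
  | succ n hmn ih =>
    refine (integral_vertexAvg_sq_succ_le hw hw1 hK (hm.trans hmn) _).trans ?_
    have hIoc := Finset.insert_Ioc_right_eq_Ioc_add_one hmn
    set q : ℕ → ℝ := fun j => w j / totalWeight w j with hq
    have e1 : ∀ ω, vertexAvg w (fun m => K m ω) n (fun s =>
        (1 - w (n + 1) / totalWeight w (n + 1)) * f (s ∩ Finset.Ioc m (n + 1)) +
          w (n + 1) / totalWeight w (n + 1) * f (insert (n + 1) s ∩ Finset.Ioc m (n + 1))) =
        vertexAvg w (fun m => K m ω) n (fun s => (fun s =>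
          (1 - q (n + 1)) * f s + q (n + 1) * f (insert (n + 1) s)) (s ∩ Finset.Ioc m n)) := by
      refine fun ω => vertexAvg_congr fun s hs => ?_
      have hns : n + 1 ∉ s := fun h => by simpa using hs h
      rw [← hIoc, Finset.inter_insert_of_notMem hns, ← Finset.insert_inter_distrib]
    have e2 : ∀ ω, vertexAvg w (fun m => K m ω) n (fun s =>
        f (insert (n + 1) s ∩ Finset.Ioc m (n + 1)) ^ 2) =
        vertexAvg w (fun m => K m ω) n (fun s => (fun s =>
          f (insert (n + 1) s) ^ 2) (s ∩ Finset.Ioc m n)) := by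
      refine fun ω => vertexAvg_congr fun s hs => ?_
      rw [← hIoc, ← Finset.insert_inter_distrib]
    rw [integral_congr_ae (ae_of_all P e2), integral_congr_ae (ae_of_all P fun ω => by
      simpa only using congrArg (· ^ 2) (e1 ω))]
    rw [integral_vertexAvg hw hw1 hK hm hmn (fun s => f (insert (n + 1) s) ^ 2)]
    -- The choice for label `n + 1` is averaged into the function, so the induction hypothesis is
    -- applied to a new `f`.
    refine (add_le_add_left (ih fun s =>
      (1 - q (n + 1)) * f s + q (n + 1) * f (insert (n + 1) s)) _).trans (le_of_eq ?_)
    rw [← hIoc, subsetAvg_insert _ (by simp), Finset.sum_insert (by simp), add_assoc,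
      add_comm (∑ l ∈ Finset.Ioc m n, _)]
    congr 2
    -- The new term `l = n + 1`: nothing lies above it, so the inner average is over `∅`.
    · simp [q]
    · refine Finset.sum_congr rfl fun l hl => ?_
      congr 2
      funext a
      rw [← Finset.insert_Ioc_right_eq_Ioc_add_one (Finset.mem_Ioc.1 hl).2,
        subsetAvg_insert _ (by simp)]
      simp [Finset.union_insert]

end

/-! ### Excursions of the walk -/

theorem timeIndex_apply {i : ℕ → ℕ} (hi : StrictMono i) (t : ℕ) : timeIndex i (i t) = t :=
  (timeIndex_eq_iff hi t).2 ⟨le_rfl, fun h => hi (by omega)⟩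

theorem timeIndex_of_mem_Ioc {i : ℕ → ℕ} (hi : StrictMono i) {r j : ℕ}
    (hj : j ∈ Finset.Ioc (i r) (i (r + 1))) : timeIndex i j = r + 1 := by
  rw [Finset.mem_Ioc] at hj
  exact (timeIndex_eq_iff hi _).2 ⟨hj.2, fun _ => hj.1⟩

theorem le_apply_timeIndex {i : ℕ → ℕ} (hi : StrictMono i) (j : ℕ) : j ≤ i (timeIndex i j) :=
  ((timeIndex_eq_iff hi _).1 rfl).1

theorem lt_timeIndex_iff {i : ℕ → ℕ} (hi : StrictMono i) {r j : ℕ} :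
    r < timeIndex i j ↔ i r < j := by
  constructor
  · intro h
    by_contra hc
    have : timeIndex i j ≤ r := Nat.sInf_le (show j ≤ i r by omega)
    omega
  · intro h
    exact hi.lt_iff_lt.1 (h.trans_le (le_apply_timeIndex hi j))

/-- For a set `s` of labels in `(i_T, i_t]`, the path `r ↦ |s ∩ (i_T, i_{T+r}]| - r` is an excursion
below `0` that ends at `0` at time `t - T`. -/
def IsExcursion (i : ℕ → ℕ) (T t : ℕ) (s : Finset ℕ) : Prop :=
  s.card = t - T ∧ ∀ r < t - T, (s.filter (· ≤ i (T + r))).card ≤ r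

/-- Of the `t - T` labels, at most `r - T` are `≤ i_r`, so the others come later. -/
theorem IsExcursion.le_card_filter {i : ℕ → ℕ} {T t : ℕ} {s : Finset ℕ}
    (h : IsExcursion i T t s) {r : ℕ} (hT : T ≤ r) :
    t - r ≤ (s.filter (i r < ·)).card := by
  have hsplit := Finset.card_filter_add_card_filter_not (s := s) (p := fun j => j ≤ i r)
  simp only [not_le] at hsplit
  rcases lt_or_ge r t with hrt | hrt
  · have h2 := h.2 (r - T) (by omega)
    rw [Nat.add_sub_cancel' hT] at h2
    have := h.1
    omega
  · omega

/-- Peel off the first block, whose labels contribute exactly `θ (s + 1)` each. The later labels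
number at least `d`, so their surplus can be valued at `θ (s + 1) ≤ θ (s + 2)`. Keeping the surplus
term on the left is what makes the induction close. -/
theorem sum_sub_sum_ge_of_le_card {i : ℕ → ℕ} (hi : StrictMono i) {θ : ℕ → ℝ} {r₀ : ℕ}
    (hθ : MonotoneOn θ (Set.Ici r₀)) (d : ℕ) {s : ℕ} (hs : r₀ ≤ s + 1) {v : Finset ℕ}
    (hv : v ⊆ Finset.Ioc (i s) (i (s + d)))
    (hcard : ∀ r, s ≤ r → s + d - r ≤ (v.filter (i r < ·)).card) :
    θ (s + 1) * ((v.card : ℝ) - d) ≤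
      ∑ j ∈ v, θ (timeIndex i j) - ∑ r ∈ Finset.Ioc s (s + d), θ r := by
  induction d generalizing s v with
  | zero =>
    have : v = ∅ := by simpa using hv
    simp [this]
  | succ d ih =>
    have ih' := ih (s := s + 1) (v := v.filter (i (s + 1) < ·)) (by omega)
      (fun j hj => by
        rw [Finset.mem_filter] at hj
        have := Finset.mem_Ioc.1 (hv hj.1)
        rw [show s + 1 + d = s + (d + 1) by omega]
        exact Finset.mem_Ioc.2 ⟨hj.2, this.2⟩)
      (fun r hr => by
        have h := hcard r (by omega)
        rw [Finset.filter_filter, Finset.filter_congr (q := fun j => i r < j)]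
        · omega
        · intro j _
          have := hi.monotone hr
          exact ⟨fun h => h.2, fun h => ⟨by omega, h⟩⟩)
    have hge := hcard (s + 1) (by omega)
    have hmono : θ (s + 1) ≤ θ (s + 1 + 1) :=
      hθ (Set.mem_Ici.2 hs) (Set.mem_Ici.2 (by omega)) (by omega)
    have hlow : ∑ j ∈ v.filter (fun j => ¬ i (s + 1) < j), θ (timeIndex i j) =
        (v.filter (fun j => ¬ i (s + 1) < j)).card * θ (s + 1) := by
      rw [← nsmul_eq_mul]
      refine Finset.sum_eq_card_nsmul fun j hj => ?_
      rw [Finset.mem_filter, not_lt] at hj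
      rw [timeIndex_of_mem_Ioc hi (Finset.mem_Ioc.2 ⟨(Finset.mem_Ioc.1 (hv hj.1)).1, hj.2⟩)]
    have hsum := Finset.sum_filter_add_sum_filter_not v (i (s + 1) < ·)
      (fun j => θ (timeIndex i j))
    have hcard2 := Finset.card_filter_add_card_filter_not (s := v) (p := fun j => i (s + 1) < j)
    have hIoc : ∑ r ∈ Finset.Ioc s (s + (d + 1)), θ r =
        θ (s + 1) + ∑ r ∈ Finset.Ioc (s + 1) (s + 1 + d), θ r := by
      rw [show s + (d + 1) = s + 1 + d by omega,
        ← Finset.insert_Ioc_add_one_left_eq_Ioc (by omega), Finset.sum_insert (by simp)]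
    rw [hIoc, ← hsum, hlow, ← hcard2]
    have h3 : (d : ℝ) ≤ ((v.filter (i (s + 1) < ·)).card : ℝ) := by
      exact_mod_cast (by omega : d ≤ (v.filter (i (s + 1) < ·)).card)
    have h4 := mul_le_mul_of_nonneg_right hmono (sub_nonneg.2 h3)
    push_cast
    linarith

theorem sum_Ioc_le_sum_of_le_card {i : ℕ → ℕ} (hi : StrictMono i) {θ : ℕ → ℝ} {r₀ : ℕ}
    (hθ : MonotoneOn θ (Set.Ici r₀)) (hθ0 : ∀ r, r₀ ≤ r → 0 ≤ θ r) {s t : ℕ} (hst : s ≤ t)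
    (hs : r₀ ≤ s + 1) {v : Finset ℕ} (hv : v ⊆ Finset.Ioc (i s) (i t))
    (hcard : ∀ r, s ≤ r → t - r ≤ (v.filter (i r < ·)).card) :
    ∑ r ∈ Finset.Ioc s t, θ r ≤ ∑ j ∈ v, θ (timeIndex i j) := by
  obtain ⟨d, rfl⟩ := Nat.exists_eq_add_of_le hst
  have h := sum_sub_sum_ge_of_le_card hi hθ d hs hv hcard
  have h1 : d ≤ v.card := by
    have := (hcard s le_rfl).trans (Finset.card_filter_le _ _)
    omega
  have h2 : 0 ≤ θ (s + 1) * ((v.card : ℝ) - d) :=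
    mul_nonneg (hθ0 _ hs) (sub_nonneg.2 (by exact_mod_cast h1))
  linarith

theorem IsExcursion.sum_Ioc_le {i : ℕ → ℕ} (hi : StrictMono i) {θ : ℕ → ℝ} {r₀ : ℕ}
    (hθ : MonotoneOn θ (Set.Ici r₀)) (hθ0 : ∀ r, r₀ ≤ r → 0 ≤ θ r) {T t : ℕ} (hTt : T ≤ t)
    (hT : r₀ ≤ T + 1) {u : Finset ℕ} (hu : IsExcursion i T t u)
    (hsub : u ⊆ Finset.Ioc (i T) (i t)) :
    ∑ r ∈ Finset.Ioc T t, θ r ≤ ∑ j ∈ u, θ (timeIndex i j) :=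
  sum_Ioc_le_sum_of_le_card hi hθ hθ0 hTt hT hsub fun _ hr => hu.le_card_filter hr

/-- The labels from `l` on still satisfy the counting condition, now started at time `t_l - 1`. -/
theorem IsExcursion.sum_Ioc_le_sum_filter {i : ℕ → ℕ} (hi : StrictMono i) {θ : ℕ → ℝ} {r₀ : ℕ}
    (hθ : MonotoneOn θ (Set.Ici r₀)) (hθ0 : ∀ r, r₀ ≤ r → 0 ≤ θ r) {T t : ℕ}
    (hT : r₀ ≤ T + 1) {u : Finset ℕ} (hu : IsExcursion i T t u)
    (hsub : u ⊆ Finset.Ioc (i T) (i t)) {l : ℕ} (hl : l ∈ u) :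
    ∑ r ∈ Finset.Ioc (timeIndex i l - 1) t, θ r ≤
      ∑ j ∈ u.filter (l ≤ ·), θ (timeIndex i j) := by
  have hlu := Finset.mem_Ioc.1 (hsub hl)
  have hTs : T < timeIndex i l := (lt_timeIndex_iff hi).2 hlu.1
  have hst : timeIndex i l ≤ t := Nat.sInf_le hlu.2
  have hil : i (timeIndex i l - 1) < l := (lt_timeIndex_iff hi).1 (by omega)
  have hli := le_apply_timeIndex hi l
  refine sum_Ioc_le_sum_of_le_card hi hθ hθ0 (by omega) (by omega) ?_ ?_
  · intro j hj
    rw [Finset.mem_filter] at hj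
    exact Finset.mem_Ioc.2 ⟨by omega, (Finset.mem_Ioc.1 (hsub hj.1)).2⟩
  · intro r hr
    -- At `r = t_l - 1`, other labels in the block of `l` may be smaller than `l`. Instead count `l`
    -- itself together with the at least `t - t_l` labels of later blocks.
    rcases Nat.eq_or_lt_of_le hr with h | h
    · have h1 := hu.le_card_filter (r := timeIndex i l) hTs.le
      have h2 : insert l (u.filter (i (timeIndex i l) < ·)) ⊆
          (u.filter (l ≤ ·)).filter (i r < ·) := by
        intro j hj
        rw [Finset.mem_insert, Finset.mem_filter] at hj
        rw [Finset.mem_filter, Finset.mem_filter, ← h]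
        rcases hj with rfl | hj
        · exact ⟨⟨hl, le_rfl⟩, hil⟩
        · exact ⟨⟨hj.1, by omega⟩, by omega⟩
      have h3 := Finset.card_le_card h2
      rw [Finset.card_insert_of_notMem (by simp [hli])] at h3
      omega
    · refine (hu.le_card_filter (r := r) (by omega)).trans (Finset.card_le_card ?_)
      intro j hj
      have := hi.monotone (show timeIndex i l ≤ r by omega)
      rw [Finset.mem_filter] at hj
      rw [Finset.mem_filter, Finset.mem_filter]
      exact ⟨⟨hj.1, by omega⟩, hj.2⟩

/-- Summation by parts along the walk. -/
theorem sum_sub_sum_eq_by_parts {i : ℕ → ℕ} (hi : StrictMono i) (θ : ℕ → ℝ) (T d : ℕ)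
    {u : Finset ℕ} (hu : u ⊆ Finset.Ioc (i T) (i (T + d))) :
    ∑ j ∈ u, θ (timeIndex i j) - ∑ r ∈ Finset.Ioc T (T + d), θ r =
      θ (T + d) * ((u.card : ℝ) - d) - ∑ r ∈ Finset.range d, (θ (T + r + 1) - θ (T + r)) *
        (((u.filter (· ≤ i (T + r))).card : ℝ) - r) := by
  induction d generalizing u with
  | zero =>
    have : u = ∅ := by simpa using hu
    simp [this]
  | succ d ih =>
    have ih' := ih (u := u.filter (· ≤ i (T + d))) (fun j hj => by
      rw [Finset.mem_filter] at hj
      exact Finset.mem_Ioc.2 ⟨(Finset.mem_Ioc.1 (hu hj.1)).1, hj.2⟩)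
    have hcongr : ∑ r ∈ Finset.range d, (θ (T + r + 1) - θ (T + r)) *
        ((((u.filter (· ≤ i (T + d))).filter (· ≤ i (T + r))).card : ℝ) - r) =
        ∑ r ∈ Finset.range d, (θ (T + r + 1) - θ (T + r)) *
          (((u.filter (· ≤ i (T + r))).card : ℝ) - r) := by
      refine Finset.sum_congr rfl fun r hr => ?_
      have := hi.monotone (show T + r ≤ T + d by have := Finset.mem_range.1 hr; omega)
      rw [Finset.filter_filter, Finset.filter_congr (q := fun j => j ≤ i (T + r))]
      intro j _
      exact ⟨fun h => h.2, fun h => ⟨by omega, h⟩⟩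
    have hhigh : ∑ j ∈ u.filter (fun j => ¬ j ≤ i (T + d)), θ (timeIndex i j) =
        (u.filter (fun j => ¬ j ≤ i (T + d))).card * θ (T + d + 1) := by
      rw [← nsmul_eq_mul]
      refine Finset.sum_eq_card_nsmul fun j hj => ?_
      rw [Finset.mem_filter, not_le] at hj
      rw [timeIndex_of_mem_Ioc hi (Finset.mem_Ioc.2 ⟨hj.2, (Finset.mem_Ioc.1 (hu hj.1)).2⟩)]
    have hsum := Finset.sum_filter_add_sum_filter_not u (· ≤ i (T + d))
      (fun j => θ (timeIndex i j))
    have hcard := Finset.card_filter_add_card_filter_not (s := u) (p := fun j => j ≤ i (T + d))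
    have hIoc : ∑ r ∈ Finset.Ioc T (T + (d + 1)), θ r =
        ∑ r ∈ Finset.Ioc T (T + d), θ r + θ (T + d + 1) := by
      rw [← add_assoc, ← Finset.insert_Ioc_right_eq_Ioc_add_one (by omega),
        Finset.sum_insert (by simp), add_comm]
    rw [hcongr] at ih'
    rw [hIoc, ← hsum, hhigh, Finset.sum_range_succ, ← hcard, ← add_assoc]
    push_cast
    linear_combination ih'

/-- In the summation by parts, the boundary term vanishes because `u.card = t - T`, and the `r = 0`
term because no label is `≤ i_T`. Hence the exponent in `E` is a difference of `θ`-sums. -/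
theorem IsExcursion.sum_eq {i : ℕ → ℕ} (hi : StrictMono i) (θ : ℕ → ℝ) {T t : ℕ} (hTt : T < t)
    {u : Finset ℕ} (hu : IsExcursion i T t u) (hsub : u ⊆ Finset.Ioc (i T) (i t)) :
    ∑ r ∈ Finset.Icc 1 (t - T - 1), (θ (T + r + 1) - θ (T + r)) *
        (((u.filter (· ≤ i (T + r))).card : ℝ) - r) =
      ∑ r ∈ Finset.Ioc T t, θ r - ∑ j ∈ u, θ (timeIndex i j) := by
  obtain ⟨d, rfl⟩ := Nat.exists_eq_add_of_lt hTt
  have h := sum_sub_sum_eq_by_parts hi θ T (d + 1) (u := u) hsub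
  have hc : u.card = d + 1 := by have := hu.1; omega
  have h0 : u.filter (· ≤ i (T + 0)) = ∅ := by
    refine Finset.filter_eq_empty_iff.2 fun j hj => ?_
    have := Finset.mem_Ioc.1 (hsub hj)
    simp only [add_zero]
    omega
  rw [Finset.range_eq_Ico, Finset.sum_eq_sum_Ico_succ_bot (by omega), h0, hc] at h
  have hI : Finset.Icc 1 (T + d + 1 - T - 1) = Finset.Ico (0 + 1) (d + 1) := by
    ext r
    simp only [Finset.mem_Icc, Finset.mem_Ico]
    omega
  rw [hI]
  simp only [sub_self, mul_zero, Finset.card_empty, Nat.cast_zero, zero_sub, zero_add] at h ⊢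
  rw [add_assoc]
  linarith

/-! ### The walk under the tilted law -/

theorem walk_sub_walk {i : ℕ → ℕ} (hi : StrictMono i) (Y : ℕ → ℕ) (T r : ℕ) {t : ℕ}
    (h : T + r ≤ t) :
    walk i (i t) Y (T + r) - walk i (i t) Y T =
      (∑ j ∈ Finset.Ioc (i T) (i (T + r)), (Y j : ℤ)) - r := by
  induction r with
  | zero => simp
  | succ r ih =>
    have ih' := ih (by omega)
    have h1 : walk i (i t) Y (T + (r + 1)) = walk i (i t) Y (T + r) +
        ((∑ j ∈ Finset.Ioc (i (T + r)) (i (T + (r + 1))), (Y j : ℤ)) - 1) := by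
      rw [walk, ← add_assoc, Finset.sum_Icc_succ_top (by omega), walk, Nat.add_sub_cancel,
        min_eq_left (hi.monotone (by omega))]
    have h2 := Finset.sum_Ioc_consecutive (fun j => (Y j : ℤ))
      (hi.monotone (show T ≤ T + r by omega)) (hi.monotone (show T + r ≤ T + (r + 1) by omega))
    rw [h1, ← h2]
    push_cast
    linarith

theorem sum_Ioc_eq_card_filter {i : ℕ → ℕ} (hi : StrictMono i) {Y : ℕ → ℕ}
    (hY : ∀ j, Y j = 0 ∨ Y j = 1) {T r t : ℕ} (h : T + r ≤ t) :
    ∑ j ∈ Finset.Ioc (i T) (i (T + r)), (Y j : ℤ) =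
      ((((Finset.Ioc (i T) (i t)).filter (fun j => Y j = 1)).filter
        (· ≤ i (T + r))).card : ℤ) := by
  have h1 : ∀ j, (Y j : ℤ) = if Y j = 1 then 1 else 0 := by
    intro j
    rcases hY j with h | h <;> simp [h]
  simp_rw [h1]
  rw [← Finset.sum_filter, Finset.sum_const, nsmul_one]
  congr 2
  ext j
  have := hi.monotone h
  simp only [Finset.mem_filter, Finset.mem_Ioc]
  constructor
  · rintro ⟨⟨h1, h2⟩, h3⟩
    exact ⟨⟨⟨h1, by omega⟩, h3⟩, h2⟩
  · rintro ⟨⟨⟨h1, _⟩, h3⟩, h2⟩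
    exact ⟨⟨h1, h2⟩, h3⟩

open Classical in
/-- Indicator function of excursions. -/
noncomputable def excursionIndicator (i : ℕ → ℕ) (T t : ℕ) (s : Finset ℕ) : ℝ :=
  if IsExcursion i T t s then 1 else 0

/-- For `{0, 1}`-valued `Y`, the walk counts the labels with `Y j = 1`, so the event in `E` is that
these form an excursion; `IsExcursion.sum_eq` rewrites the weight. -/
theorem E_eq_subsetAvg {w : ℕ → ℝ} (hw : ∀ n, 1 ≤ n → 0 ≤ w n) {i : ℕ → ℕ}
    (hi : StrictMono i) (θ : ℕ → ℝ) (T : ℕ → ℕ) {t : ℕ} (hT : T (i t) < t) :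
    E w i θ T (i t) = Real.exp (∑ r ∈ Finset.Ioc (T (i t)) t, θ r) *
      subsetAvg (tiltedProb w i θ) (Finset.Ioc (i (T (i t))) (i t)) (fun s =>
        Real.exp (-∑ j ∈ s, θ (timeIndex i j)) * excursionIndicator i (T (i t)) t s) := by
  set T' := T (i t) with hT'
  set I := Finset.Ioc (i T') (i t) with hI
  -- The projection onto `[0, 1]` is harmless, as all labels in `I` are at least `1`.
  have hp : subsetAvg (tiltedProb w i θ) I (fun s =>
        Real.exp (-∑ j ∈ s, θ (timeIndex i j)) * excursionIndicator i T' t s) =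
      subsetAvg (fun j => ((Set.projIcc (0 : ℝ) 1 zero_le_one (tiltedProb w i θ j) :
        Set.Icc (0 : ℝ) 1) : ℝ)) I (fun s =>
        Real.exp (-∑ j ∈ s, θ (timeIndex i j)) * excursionIndicator i T' t s) := by
    refine Finset.sum_congr rfl fun s hs => ?_
    have hj : ∀ j ∈ I, ((Set.projIcc (0 : ℝ) 1 zero_le_one (tiltedProb w i θ j) :
        Set.Icc (0 : ℝ) 1) : ℝ) = tiltedProb w i θ j := by
      intro j hj
      rw [Set.projIcc_of_mem zero_le_one (tiltedProb_mem_Icc hw i θ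
        (by have := Finset.mem_Ioc.1 hj; omega))]
    rw [Finset.prod_congr rfl fun j h => hj j (Finset.mem_powerset.1 hs h),
      Finset.prod_congr rfl fun j h => congrArg (1 - ·) (hj j (Finset.mem_sdiff.1 h).1)]
  rw [hp, ← subsetAvg_const_mul, ← integral_filter_infinitePi
    (fun j => Set.projIcc (0 : ℝ) 1 zero_le_one (tiltedProb w i θ j)), E, tiltedLaw]
  refine integral_congr_ae ?_
  filter_upwards [ae_infinitePi_bernoulli
    (fun j => Set.projIcc (0 : ℝ) 1 zero_le_one (tiltedProb w i θ j))] with Y hY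
  set u := I.filter (fun j => Y j = 1) with hu
  have husub : u ⊆ I := Finset.filter_subset _ _
  rw [timeIndex_apply hi, ← hT']
  have hwalk : ∀ r, T' + r ≤ t → walk i (i t) Y (T' + r) - walk i (i t) Y T' =
      ((u.filter (· ≤ i (T' + r))).card : ℤ) - r := by
    intro r hr
    rw [walk_sub_walk hi Y T' r hr, sum_Ioc_eq_card_filter hi hY hr]
  have hend : u.filter (· ≤ i (T' + (t - T'))) = u := by
    refine Finset.filter_true_of_mem fun j hj => ?_
    rw [Nat.add_sub_cancel' hT.le]
    exact (Finset.mem_Ioc.1 (husub hj)).2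
  have hiff : Y ∈ {Y : ℕ → ℕ | walk i (i t) Y t = walk i (i t) Y T' ∧
      ∀ r < t - T', walk i (i t) Y (T' + r) ≤ walk i (i t) Y T'} ↔ IsExcursion i T' t u := by
    have h1 := hwalk (t - T') (by omega)
    rw [hend, Nat.add_sub_cancel' hT.le] at h1
    refine and_congr (by omega) (forall₂_congr fun r hr => ?_)
    have h2 := hwalk r (by omega)
    omega
  by_cases hex : IsExcursion i T' t u
  · rw [Set.indicator_of_mem (hiff.2 hex), excursionIndicator, if_pos hex, mul_one, ← Real.exp_add,
      ← sub_eq_add_neg, ← hex.sum_eq hi θ hT husub]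
    congr 1
    refine Finset.sum_congr rfl fun r hr => ?_
    rw [Finset.mem_Icc] at hr
    rw [hwalk r (by omega)]
    push_cast
    rfl
  · rw [Set.indicator_of_notMem (fun h => hex (hiff.1 h)), excursionIndicator, if_neg hex, mul_zero,
      mul_zero]

/-! ### The second moment bound -/

/-- Normalization of the exponential tilt at label `j`. -/
noncomputable def tiltMass (w : ℕ → ℝ) (i : ℕ → ℕ) (θ : ℕ → ℝ) (j : ℕ) : ℝ :=
  1 + (Real.exp (θ (timeIndex i j)) - 1) * (w j / totalWeight w j)

theorem tiltMass_pos {w : ℕ → ℝ} (hw : ∀ n, 1 ≤ n → 0 ≤ w n) (i : ℕ → ℕ) (θ : ℕ → ℝ) {j : ℕ}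
    (hj : 1 ≤ j) : 0 < tiltMass w i θ j := by
  obtain ⟨h0, h1⟩ := weight_ratio_mem_Icc hw hj
  have he := Real.exp_pos (θ (timeIndex i j))
  unfold tiltMass
  rcases h0.eq_or_lt with h | h
  · rw [← h]
    norm_num
  · have := mul_pos he h
    nlinarith

theorem one_le_tiltMass {w : ℕ → ℝ} (hw : ∀ n, 1 ≤ n → 0 ≤ w n) {i : ℕ → ℕ} {θ : ℕ → ℝ} {j : ℕ}
    (hj : 1 ≤ j) (hθ : 0 ≤ θ (timeIndex i j)) : 1 ≤ tiltMass w i θ j := by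
  have h0 := (weight_ratio_mem_Icc hw hj).1
  have := mul_nonneg (sub_nonneg.2 (Real.one_le_exp hθ)) h0
  unfold tiltMass
  linarith

theorem subsetAvg_eq_tilted {w : ℕ → ℝ} (hw : ∀ n, 1 ≤ n → 0 ≤ w n) (i : ℕ → ℕ) (θ : ℕ → ℝ)
    (m n : ℕ) (F : Finset ℕ → ℝ) :
    subsetAvg (fun j => w j / totalWeight w j) (Finset.Ioc m n) F =
      (∏ j ∈ Finset.Ioc m n, tiltMass w i θ j) *
        subsetAvg (tiltedProb w i θ) (Finset.Ioc m n)
          (fun s => Real.exp (-∑ j ∈ s, θ (timeIndex i j)) * F s) :=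
  subsetAvg_tilt (ψ := fun j => θ (timeIndex i j))
    (fun j hj => tiltMass_pos hw i θ (by have := Finset.mem_Ioc.1 hj; omega)) (fun _ _ => rfl) F

theorem tiltedProb_mem_Icc_of_mem_Ioc {w : ℕ → ℝ} (hw : ∀ n, 1 ≤ n → 0 ≤ w n) (i : ℕ → ℕ)
    (θ : ℕ → ℝ) {m n : ℕ} : ∀ j ∈ Finset.Ioc m n, tiltedProb w i θ j ∈ Set.Icc (0 : ℝ) 1 :=
  fun j hj => tiltedProb_mem_Icc hw i θ (by have := Finset.mem_Ioc.1 hj; omega)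

/-- The first moment: the untilting factor is the one in `E_eq_subsetAvg`, up to the deterministic
`θ`-sum. -/
theorem subsetAvg_excursionIndicator {w : ℕ → ℝ} (hw : ∀ n, 1 ≤ n → 0 ≤ w n) {i : ℕ → ℕ}
    (hi : StrictMono i) (θ : ℕ → ℝ) (T : ℕ → ℕ) {t : ℕ} (hT : T (i t) < t) :
    subsetAvg (fun j => w j / totalWeight w j) (Finset.Ioc (i (T (i t))) (i t))
        (excursionIndicator i (T (i t)) t) =
      (∏ j ∈ Finset.Ioc (i (T (i t))) (i t), tiltMass w i θ j) *
        Real.exp (-∑ r ∈ Finset.Ioc (T (i t)) t, θ r) * E w i θ T (i t) := by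
  rw [subsetAvg_eq_tilted hw i θ, E_eq_subsetAvg hw hi θ T hT, mul_assoc, ← mul_assoc (Real.exp _),
    ← Real.exp_add, neg_add_cancel, Real.exp_zero, one_mul]

theorem E_nonneg (w : ℕ → ℝ) (i : ℕ → ℕ) (θ : ℕ → ℝ) (T : ℕ → ℕ) (n : ℕ) : 0 ≤ E w i θ T n :=
  integral_nonneg fun _ => Set.indicator_nonneg (fun _ _ => (Real.exp_pos _).le) _

theorem excursionIndicator_mem (i : ℕ → ℕ) (T t : ℕ) (s : Finset ℕ) :
    excursionIndicator i T t s = 0 ∨ excursionIndicator i T t s = 1 ∧ IsExcursion i T t s := by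
  unfold excursionIndicator
  split_ifs with h
  · exact Or.inr ⟨rfl, h⟩
  · exact Or.inl rfl

/-- Average two lower bounds for the `θ`-mass: that of the whole excursion and that of its labels
from `l` on. The weight `1/2` leaves half of the mass of `a`, which after squaring cancels the tilt
of the outer average exactly. -/
theorem IsExcursion.neg_sum_le {i : ℕ → ℕ} (hi : StrictMono i) {θ : ℕ → ℝ} {r₀ : ℕ}
    (hθ : MonotoneOn θ (Set.Ici r₀)) (hθ0 : ∀ r, r₀ ≤ r → 0 ≤ θ r) {T t : ℕ} (hTt : T ≤ t)
    (hT : r₀ ≤ T + 1) {l : ℕ} (hl : l ∈ Finset.Ioc (i T) (i t)) {a s : Finset ℕ}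
    (ha : a ⊆ Finset.Ioc (i T) (l - 1)) (hs : s ⊆ Finset.Ioc l (i t))
    (hu : IsExcursion i T t (insert l a ∪ s)) :
    -∑ j ∈ s, θ (timeIndex i j) ≤
      (2 * θ (timeIndex i l) + ∑ r ∈ Finset.Icc (T + 1) (timeIndex i l - 1), θ r
        - 2 * ∑ r ∈ Finset.Ioc T t, θ r + ∑ j ∈ a, θ (timeIndex i j)) / 2 := by
  have hlI := Finset.mem_Ioc.1 hl
  have haI : ∀ j ∈ a, i T < j ∧ j < l := fun j hj => by
    have := Finset.mem_Ioc.1 (ha hj); omega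
  have hsI : ∀ j ∈ s, l < j ∧ j ≤ i t := fun j hj => Finset.mem_Ioc.1 (hs hj)
  have hsub : insert l a ∪ s ⊆ Finset.Ioc (i T) (i t) := by
    intro j hj
    rw [Finset.mem_union, Finset.mem_insert] at hj
    rw [Finset.mem_Ioc]
    rcases hj with (rfl | hj) | hj
    · exact hlI
    · have := haI j hj; omega
    · have := hsI j hj; omega
  have hla : l ∉ a := fun h => (haI l h).2.false
  have hls : l ∉ s := fun h => (hsI l h).1.false
  have hdisj : Disjoint (insert l a) s := by
    rw [Finset.disjoint_left]
    intro j hj hjs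
    have := hsI j hjs
    rcases Finset.mem_insert.1 hj with rfl | hj
    · exact hls hjs
    · have := haI j hj; omega
  have h1 := hu.sum_Ioc_le hi hθ hθ0 hTt hT hsub
  have h2 := hu.sum_Ioc_le_sum_filter hi hθ hθ0 hT hsub (l := l) (by simp)
  have hfilter : (insert l a ∪ s).filter (l ≤ ·) = insert l s := by
    ext j
    simp only [Finset.mem_filter, Finset.mem_union, Finset.mem_insert]
    constructor
    · rintro ⟨(rfl | hj) | hj, hlj⟩
      · exact Or.inl rfl
      · have := haI j hj; omega
      · exact Or.inr hj
    · rintro (rfl | hj)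
      · exact ⟨Or.inl (Or.inl rfl), le_rfl⟩
      · exact ⟨Or.inr hj, (hsI j hj).1.le⟩
  rw [Finset.sum_union hdisj, Finset.sum_insert hla] at h1
  rw [hfilter, Finset.sum_insert hls] at h2
  have hTl : T < timeIndex i l := (lt_timeIndex_iff hi).2 hlI.1
  have hlt : timeIndex i l ≤ t := Nat.sInf_le hlI.2
  have h3 := Finset.sum_Ioc_consecutive θ (show T ≤ timeIndex i l - 1 by omega)
    (show timeIndex i l - 1 ≤ t by omega)
  have h4 : Finset.Icc (T + 1) (timeIndex i l - 1) = Finset.Ioc T (timeIndex i l - 1) :=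
    Finset.Icc_add_one_left_eq_Ioc _ _
  rw [h4]
  linarith

theorem subsetAvg_sq_excursionIndicator_le {w : ℕ → ℝ} (hw : ∀ n, 1 ≤ n → 0 ≤ w n) {i : ℕ → ℕ}
    (hi : StrictMono i) {θ : ℕ → ℝ} {r₀ : ℕ} (hθ : MonotoneOn θ (Set.Ici r₀))
    (hθ0 : ∀ r, r₀ ≤ r → 0 ≤ θ r) {T t : ℕ} (hTt : T ≤ t) (hT : r₀ ≤ T + 1) {l : ℕ}
    (hl : l ∈ Finset.Ioc (i T) (i t)) :
    subsetAvg (fun j => w j / totalWeight w j) (Finset.Ioc (i T) (l - 1)) (fun a =>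
        subsetAvg (fun j => w j / totalWeight w j) (Finset.Ioc l (i t))
          (fun s => excursionIndicator i T t (insert l a ∪ s)) ^ 2) ≤
      (∏ j ∈ Finset.Ioc (i T) (l - 1), tiltMass w i θ j) *
        ((∏ j ∈ Finset.Ioc l (i t), tiltMass w i θ j) ^ 2 *
          Real.exp (2 * θ (timeIndex i l) + ∑ r ∈ Finset.Icc (T + 1) (timeIndex i l - 1), θ r
            - 2 * ∑ r ∈ Finset.Ioc T t, θ r)) := by
  have hpos : ∀ m n, 0 ≤ ∏ j ∈ Finset.Ioc m n, tiltMass w i θ j := fun m n =>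
    Finset.prod_nonneg fun j hj =>
      (tiltMass_pos hw i θ (by have := Finset.mem_Ioc.1 hj; omega)).le
  rw [subsetAvg_eq_tilted hw i θ (i T)]
  refine mul_le_mul_of_nonneg_left ?_ (hpos _ _)
  refine subsetAvg_le_of_le (tiltedProb_mem_Icc_of_mem_Ioc hw i θ) fun a ha => ?_
  set c := 2 * θ (timeIndex i l) + ∑ r ∈ Finset.Icc (T + 1) (timeIndex i l - 1), θ r
    - 2 * ∑ r ∈ Finset.Ioc T t, θ r with hc
  have hnonneg : ∀ s, 0 ≤ Real.exp (-∑ j ∈ s, θ (timeIndex i j)) *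
      excursionIndicator i T t (insert l a ∪ s) := by
    intro s
    refine mul_nonneg (Real.exp_pos _).le ?_
    rcases excursionIndicator_mem i T t (insert l a ∪ s) with h | h
    · rw [h]
    · rw [h.1]
      exact zero_le_one
  have hinner : subsetAvg (tiltedProb w i θ) (Finset.Ioc l (i t)) (fun s =>
      Real.exp (-∑ j ∈ s, θ (timeIndex i j)) * excursionIndicator i T t (insert l a ∪ s)) ≤
      Real.exp ((c + ∑ j ∈ a, θ (timeIndex i j)) / 2) := by
    refine subsetAvg_le_of_le (tiltedProb_mem_Icc_of_mem_Ioc hw i θ) fun s hs => ?_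
    rcases excursionIndicator_mem i T t (insert l a ∪ s) with h | h
    · rw [h, mul_zero]
      exact (Real.exp_pos _).le
    · rw [h.1, mul_one]
      exact Real.exp_le_exp.2 (h.2.neg_sum_le hi hθ hθ0 hTt hT hl ha hs)
  have hinner0 := subsetAvg_nonneg (F := fun s => Real.exp (-∑ j ∈ s, θ (timeIndex i j)) *
      excursionIndicator i T t (insert l a ∪ s))
    (tiltedProb_mem_Icc_of_mem_Ioc hw i θ (m := l) (n := i t)) (fun s _ => hnonneg s)
  -- Tilting the inner average as well, its square is at most `B ^ 2 * exp (c + ∑ a)`, `B` being the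
  -- tilt mass above `l`; the outer factor `exp (-∑ a)` removes the dependence on `a`.
  rw [subsetAvg_eq_tilted hw i θ l, mul_pow, mul_left_comm]
  refine mul_le_mul_of_nonneg_left ?_ (sq_nonneg _)
  refine (mul_le_mul_of_nonneg_left (pow_le_pow_left₀ hinner0 hinner 2)
    (Real.exp_pos _).le).trans (le_of_eq ?_)
  rw [← Real.exp_nat_mul, ← Real.exp_add]
  congr 1
  push_cast
  ring

/-! ### Comparison with `delta₁` and `delta₂` -/

/-- Termwise, `log (1 + x) ≥ 2x / (x + 2) ≥ x - x² / 2` for `x ≥ 0`. -/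
theorem exp_sum_sub_le_prod_one_add {I : Finset ℕ} {x : ℕ → ℝ} (hx : ∀ j ∈ I, 0 ≤ x j) :
    Real.exp (∑ j ∈ I, x j - (∑ j ∈ I, x j ^ 2) / 2) ≤ ∏ j ∈ I, (1 + x j) := by
  rw [Finset.sum_div, ← Finset.sum_sub_distrib, Real.exp_sum]
  refine Finset.prod_le_prod (fun j _ => (Real.exp_pos _).le) fun j hj => ?_
  have h0 := hx j hj
  have h1 := Real.le_log_one_add_of_nonneg h0
  have h2 : x j - x j ^ 2 / 2 ≤ 2 * x j / (x j + 2) := by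
    rw [le_div_iff₀ (by linarith)]
    have : 0 ≤ x j ^ 3 := by positivity
    nlinarith
  rw [← Real.le_log_iff_exp_le (by linarith)]
  linarith

theorem sum_le_tsum_subtype_ge (f : ℕ → ℝ≥0∞) {a : ℕ} {S : Finset ℕ} (hS : ∀ l ∈ S, a ≤ l) :
    ∑ l ∈ S, f l ≤ ∑' l : {l : ℕ // a ≤ l}, f l := by
  rw [← Finset.sum_subtype_of_mem f hS]
  exact ENNReal.sum_le_tsum _

/-- Summand of `delta₂`. -/
noncomputable def delta₂Term (w : ℕ → ℝ) (i : ℕ → ℕ) (θ : ℕ → ℝ) (T : ℕ) (l : ℕ) : ℝ :=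
  Real.exp (2 * θ (timeIndex i l)) * (w l ^ 2 / totalWeight w l ^ 2) *
    Real.exp (∑ r ∈ Finset.Icc (T + 1) (timeIndex i l - 1), θ r -
      ∑ j ∈ Finset.Icc (i T + 1) (i (timeIndex i l - 1)),
        (Real.exp (θ (timeIndex i j)) - 1) * (w j / totalWeight w j))

theorem delta₂Term_nonneg (w : ℕ → ℝ) (i : ℕ → ℕ) (θ : ℕ → ℝ) (T : ℕ) (l : ℕ) :
    0 ≤ delta₂Term w i θ T l := by
  unfold delta₂Term
  positivity

/-- The quadratic error in replacing the product by an exponential is at most `δ₁ / 2`, because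
`(e^θ - 1)² ≤ e^{2θ}` for `θ ≥ 0`. -/
theorem exp_sum_le_mul_prod_tiltMass {w : ℕ → ℝ} (hw : ∀ n, 1 ≤ n → 0 ≤ w n) {i : ℕ → ℕ}
    (hi : StrictMono i) {θ : ℕ → ℝ} {r₀ : ℕ} (hθ0 : ∀ r, r₀ ≤ r → 0 ≤ θ r) {T : ℕ → ℕ} {n : ℕ}
    (hT : r₀ ≤ T n + 1) (hδ : delta₁ w i θ T n ≠ ∞) (b : ℕ) :
    Real.exp (∑ j ∈ Finset.Icc (i (T n) + 1) b,
        (Real.exp (θ (timeIndex i j)) - 1) * (w j / totalWeight w j)) ≤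
      Real.exp ((delta₁ w i θ T n).toReal / 2) *
        ∏ j ∈ Finset.Ioc (i (T n)) b, tiltMass w i θ j := by
  rw [Finset.Icc_add_one_left_eq_Ioc]
  set x : ℕ → ℝ := fun j => (Real.exp (θ (timeIndex i j)) - 1) * (w j / totalWeight w j)
  have hj : ∀ j ∈ Finset.Ioc (i (T n)) b, 1 ≤ j ∧ 0 ≤ θ (timeIndex i j) := by
    intro j hj
    have h := (Finset.mem_Ioc.1 hj).1
    have h2 := (lt_timeIndex_iff hi).2 h
    exact ⟨by omega, hθ0 _ (by omega)⟩
  have hx : ∀ j ∈ Finset.Ioc (i (T n)) b, 0 ≤ x j := fun j h =>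
    mul_nonneg (sub_nonneg.2 (Real.one_le_exp (hj j h).2)) (weight_ratio_mem_Icc hw (hj j h).1).1
  have hsq : ∑ j ∈ Finset.Ioc (i (T n)) b, x j ^ 2 ≤ (delta₁ w i θ T n).toReal := by
    have h1 : ∑ j ∈ Finset.Ioc (i (T n)) b, x j ^ 2 ≤ ∑ j ∈ Finset.Ioc (i (T n)) b,
        Real.exp (2 * θ (timeIndex i j)) * (w j ^ 2 / totalWeight w j ^ 2) := by
      refine Finset.sum_le_sum fun j h => ?_
      rw [two_mul, Real.exp_add, ← sq, ← div_pow, ← mul_pow]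
      refine pow_le_pow_left₀ (hx j h) ?_ 2
      exact mul_le_mul_of_nonneg_right (by linarith) (weight_ratio_mem_Icc hw (hj j h).1).1
    refine h1.trans ?_
    rw [← ENNReal.ofReal_le_iff_le_toReal hδ, ENNReal.ofReal_sum_of_nonneg
      fun j _ => by positivity]
    exact sum_le_tsum_subtype_ge (fun l => ENNReal.ofReal
      (Real.exp (2 * θ (timeIndex i l)) * (w l ^ 2 / totalWeight w l ^ 2)))
      fun l hl => (Finset.mem_Ioc.1 hl).1
  have hprod : Real.exp (∑ j ∈ Finset.Ioc (i (T n)) b, x j -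
      (∑ j ∈ Finset.Ioc (i (T n)) b, x j ^ 2) / 2) ≤
        ∏ j ∈ Finset.Ioc (i (T n)) b, tiltMass w i θ j := exp_sum_sub_le_prod_one_add hx
  refine le_trans ?_ (mul_le_mul_of_nonneg_left hprod (Real.exp_pos _).le)
  rw [← Real.exp_add]
  exact Real.exp_le_exp.2 (by linarith)

/-- With `A`, `M`, `B` the tilt masses below, at and above `l`, the previous bound carries `A B²`
while the target carries `(A M B)²`. The gap is filled by `M ≥ 1` and `1 ≤ D * A * exp (-X)`. -/
theorem sq_mul_subsetAvg_le {w : ℕ → ℝ} (hw : ∀ n, 1 ≤ n → 0 ≤ w n) {i : ℕ → ℕ}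
    (hi : StrictMono i) {θ : ℕ → ℝ} {r₀ : ℕ} (hθ : MonotoneOn θ (Set.Ici r₀))
    (hθ0 : ∀ r, r₀ ≤ r → 0 ≤ θ r) {T : ℕ → ℕ} {t : ℕ} (hTt : T (i t) ≤ t)
    (hT : r₀ ≤ T (i t) + 1) (hδ : delta₁ w i θ T (i t) ≠ ∞) {l : ℕ}
    (hl : l ∈ Finset.Ioc (i (T (i t))) (i t)) :
    (w l / totalWeight w l) ^ 2 *
      subsetAvg (fun j => w j / totalWeight w j) (Finset.Ioc (i (T (i t))) (l - 1)) (fun a =>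
        subsetAvg (fun j => w j / totalWeight w j) (Finset.Ioc l (i t))
          (fun s => excursionIndicator i (T (i t)) t (insert l a ∪ s)) ^ 2) ≤
      ((∏ j ∈ Finset.Ioc (i (T (i t))) (i t), tiltMass w i θ j) *
        Real.exp (-∑ r ∈ Finset.Ioc (T (i t)) t, θ r)) ^ 2 *
        (Real.exp ((delta₁ w i θ T (i t)).toReal / 2) * delta₂Term w i θ (T (i t)) l) := by
  have h1 := subsetAvg_sq_excursionIndicator_le hw hi hθ hθ0 hTt hT hl
  have hlI := Finset.mem_Ioc.1 hl
  have hTl := (lt_timeIndex_iff hi).2 hlI.1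
  have hil : i (timeIndex i l - 1) < l := (lt_timeIndex_iff hi).1 (by omega)
  have hiT := hi.monotone (show T (i t) ≤ timeIndex i l - 1 by omega)
  have h2 := exp_sum_le_mul_prod_tiltMass hw hi hθ0 hT hδ (i (timeIndex i l - 1))
  have hone : ∀ j, i (T (i t)) < j → 1 ≤ tiltMass w i θ j := fun j hj =>
    one_le_tiltMass hw (by omega) (hθ0 _ (by have := (lt_timeIndex_iff hi).2 hj; omega))
  -- `delta₂` stops at the end of the block before `l`; extending the product to `l - 1` only
  -- increases it, as all masses are at least `1`.
  have hA' : ∏ j ∈ Finset.Ioc (i (T (i t))) (i (timeIndex i l - 1)), tiltMass w i θ j ≤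
      ∏ j ∈ Finset.Ioc (i (T (i t))) (l - 1), tiltMass w i θ j := by
    refine Finset.prod_le_prod_of_subset_of_one_le (Finset.Ioc_subset_Ioc_right (by omega))
      (fun j hj => zero_le_one.trans (hone j (Finset.mem_Ioc.1 hj).1))
      (fun j hj _ => hone j (Finset.mem_Ioc.1 hj).1)
  have hsplit : ∏ j ∈ Finset.Ioc (i (T (i t))) (i t), tiltMass w i θ j =
      (∏ j ∈ Finset.Ioc (i (T (i t))) (l - 1), tiltMass w i θ j) * tiltMass w i θ l *
        ∏ j ∈ Finset.Ioc l (i t), tiltMass w i θ j := by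
    rw [← Finset.prod_Ioc_consecutive _ hlI.1.le hlI.2]
    congr 1
    conv_lhs => rw [← Nat.sub_add_cancel (show 1 ≤ l by omega),
      ← Finset.insert_Ioc_right_eq_Ioc_add_one (by omega)]
    rw [Finset.prod_insert (by simp), Nat.sub_add_cancel (by omega), mul_comm]
  rw [hsplit]
  set A := ∏ j ∈ Finset.Ioc (i (T (i t))) (l - 1), tiltMass w i θ j
  set B := ∏ j ∈ Finset.Ioc l (i t), tiltMass w i θ j
  set D := Real.exp ((delta₁ w i θ T (i t)).toReal / 2)
  set X := ∑ j ∈ Finset.Icc (i (T (i t)) + 1) (i (timeIndex i l - 1)),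
    (Real.exp (θ (timeIndex i j)) - 1) * (w j / totalWeight w j) with hX
  set Θ := ∑ r ∈ Finset.Ioc (T (i t)) t, θ r
  set Θ' := ∑ r ∈ Finset.Icc (T (i t) + 1) (timeIndex i l - 1), θ r
  have hA0 : 0 ≤ A := Finset.prod_nonneg fun j hj =>
    zero_le_one.trans (hone j (Finset.mem_Ioc.1 hj).1)
  have hM := hone l hlI.1
  set M := tiltMass w i θ l
  have hD : 0 < D := Real.exp_pos _
  have hXA : Real.exp X ≤ D * A := h2.trans (mul_le_mul_of_nonneg_left hA' hD.le)
  have hone' : 1 ≤ D * A * Real.exp (-X) := by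
    rw [Real.exp_neg, ← div_eq_mul_inv, le_div_iff₀ (Real.exp_pos _), one_mul]
    exact hXA
  have hdelta : delta₂Term w i θ (T (i t)) l =
      (w l / totalWeight w l) ^ 2 * Real.exp (2 * θ (timeIndex i l) + Θ') * Real.exp (-X) := by
    rw [delta₂Term, ← hX, sub_eq_add_neg, Real.exp_add, Real.exp_add, div_pow]
    ring
  rw [hdelta]
  calc _ ≤ (w l / totalWeight w l) ^ 2 * (A * (B ^ 2 *
        Real.exp (2 * θ (timeIndex i l) + Θ' - 2 * Θ))) :=
        mul_le_mul_of_nonneg_left h1 (sq_nonneg _)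
    _ = (w l / totalWeight w l) ^ 2 * Real.exp (2 * θ (timeIndex i l) + Θ') * A * B ^ 2 *
        Real.exp (-Θ) ^ 2 * 1 := by
        rw [sub_eq_add_neg (2 * θ (timeIndex i l) + Θ'), Real.exp_add _ (-(2 * Θ)),
          ← Real.exp_nat_mul (-Θ)]
        push_cast
        rw [mul_neg]
        ring
    _ ≤ (w l / totalWeight w l) ^ 2 * Real.exp (2 * θ (timeIndex i l) + Θ') * A * B ^ 2 *
        Real.exp (-Θ) ^ 2 * (M ^ 2 * (D * A * Real.exp (-X))) := by
        refine mul_le_mul_of_nonneg_left (one_le_mul_of_one_le_of_one_le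
          (one_le_pow₀ hM) hone') ?_
        positivity
    _ = _ := by ring

section

variable {Ω : Type*} [MeasurableSpace Ω] {P : Measure Ω} [IsProbabilityMeasure P]
  {w : ℕ → ℝ} {K : ℕ → Ω → ℕ}

/-- Chebyshev's inequality with deviation equal to the mean `G * E`; the factor `G ^ 2` cancels
against the variance bound. -/
theorem measure_vertexAvg_eq_zero_le (hw : ∀ n, 1 ≤ n → 0 ≤ w n) (hw1 : 0 < w 1)
    (hK : IsWRT P w K) {i : ℕ → ℕ} (hi : StrictMono i) (hi0 : i 0 = 1) {θ : ℕ → ℝ} {r₀ : ℕ}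
    (hθ : MonotoneOn θ (Set.Ici r₀)) (hθ0 : ∀ r, r₀ ≤ r → 0 ≤ θ r) {T : ℕ → ℕ} {t : ℕ}
    (hTt : T (i t) < t) (hT : r₀ ≤ T (i t) + 1) (hδ : delta₁ w i θ T (i t) ≠ ∞)
    (hE : E w i θ T (i t) ≠ 0) :
    P {ω | vertexAvg w (fun m => K m ω) (i t) (fun s => excursionIndicator i (T (i t)) t
        (s ∩ Finset.Ioc (i (T (i t))) (i t))) = 0} ≤
      ENNReal.ofReal (Real.exp ((delta₁ w i θ T (i t)).toReal / 2)) *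
        (delta₂ w i θ T (i t) / ENNReal.ofReal (E w i θ T (i t) ^ 2)) := by
  have hm : 1 ≤ i (T (i t)) := hi0 ▸ hi.monotone (Nat.zero_le _)
  have hmn : i (T (i t)) ≤ i t := hi.monotone hTt.le
  have hEpos : 0 < E w i θ T (i t) := lt_of_le_of_ne (E_nonneg _ _ _ _ _) hE.symm
  set f : Finset ℕ → ℝ := fun s => excursionIndicator i (T (i t)) t
        (s ∩ Finset.Ioc (i (T (i t))) (i t))
  set Z : Ω → ℝ := fun ω => vertexAvg w (fun m => K m ω) (i t) f
  set D := Real.exp ((delta₁ w i θ T (i t)).toReal / 2)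
  set G := (∏ j ∈ Finset.Ioc (i (T (i t))) (i t), tiltMass w i θ j) *
        Real.exp (-∑ r ∈ Finset.Ioc (T (i t)) t, θ r)
  have hG : 0 < G := mul_pos (Finset.prod_pos fun j hj =>
    tiltMass_pos hw i θ (by have := Finset.mem_Ioc.1 hj; omega)) (Real.exp_pos _)
  have hmean0 : ∫ ω, Z ω ∂P = _ :=
    integral_vertexAvg hw hw1 hK hm hmn (excursionIndicator i (T (i t)) t)
  have hmean : ∫ ω, Z ω ∂P = G * E w i θ T (i t) :=
    hmean0.trans (subsetAvg_excursionIndicator hw hi θ T hTt)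
  have hsq : ∫ ω, Z ω ^ 2 ∂P ≤ (∫ ω, Z ω ∂P) ^ 2 +
      G ^ 2 * (D * ∑ l ∈ Finset.Ioc (i (T (i t))) (i t), delta₂Term w i θ (T (i t)) l) := by
    refine (integral_vertexAvg_sq_le hw hw1 hK hm hmn
      (excursionIndicator i (T (i t)) t)).trans ?_
    rw [hmean0, Finset.mul_sum, Finset.mul_sum]
    exact add_le_add_right (Finset.sum_le_sum fun l hl =>
      sq_mul_subsetAvg_le hw hi hθ hθ0 hTt.le hT hδ hl) _
  have hZmeas : Measurable Z := (measurable_vertexAvg hK _ f).mono (treeSigma_le hK _) le_rfl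
  have hZ : MemLp Z 2 P := by
    obtain ⟨C, hC⟩ := exists_abs_vertexAvg_le w f (i t)
    exact MemLp.of_bound hZmeas.aestronglyMeasurable C (ae_of_all _ fun ω => hC _)
  have hvar : variance Z P ≤
      G ^ 2 * (D * ∑ l ∈ Finset.Ioc (i (T (i t))) (i t), delta₂Term w i θ (T (i t)) l) := by
    rw [variance_eq_sub hZ]
    have : ∫ ω, (Z ^ 2) ω ∂P = ∫ ω, Z ω ^ 2 ∂P := rfl
    rw [this]
    linarith
  have hcheb := meas_ge_le_variance_div_sq hZ (mul_pos hG hEpos)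
  refine (measure_mono fun ω hω => ?_).trans (hcheb.trans ?_)
  · have hω' : Z ω = 0 := hω
    change G * E w i θ T (i t) ≤ |Z ω - ∫ ω, Z ω ∂P|
    rw [hω', hmean, zero_sub, abs_neg]
    exact le_abs_self _
  · have hsum : ENNReal.ofReal (∑ l ∈ Finset.Ioc (i (T (i t))) (i t),
        delta₂Term w i θ (T (i t)) l) ≤ delta₂ w i θ T (i t) := by
      rw [ENNReal.ofReal_sum_of_nonneg fun l _ => delta₂Term_nonneg _ _ _ _ _]
      exact sum_le_tsum_subtype_ge (fun l => ENNReal.ofReal (delta₂Term w i θ (T (i t)) l))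
        fun l hl => (Finset.mem_Ioc.1 hl).1
    have hle : variance Z P / (G * E w i θ T (i t)) ^ 2 ≤
        D * ((∑ l ∈ Finset.Ioc (i (T (i t))) (i t), delta₂Term w i θ (T (i t)) l) /
          E w i θ T (i t) ^ 2) := by
      rw [div_le_iff₀ (by positivity)]
      refine hvar.trans (le_of_eq ?_)
      field_simp
    refine (ENNReal.ofReal_le_ofReal hle).trans ?_
    rw [ENNReal.ofReal_mul (Real.exp_pos _).le, ENNReal.ofReal_div_of_pos (by positivity)]
    gcongr

end

/-! ### From excursions to the height -/

theorem treeHeight_mono (K : ℕ → ℕ) {m n : ℕ} (h : m ≤ n) : treeHeight K m ≤ treeHeight K n :=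
  Finset.sup_mono (Finset.Icc_subset_Icc_right h)

theorem le_treeHeight_of_vertexAvg_ne_zero {w : ℕ → ℝ} {K : ℕ → ℕ} {n : ℕ} {i : ℕ → ℕ}
    {T t : ℕ} {I : Finset ℕ}
    (h : vertexAvg w K n (fun s => excursionIndicator i T t (s ∩ I)) ≠ 0) :
    t - T ≤ treeHeight K n := by
  obtain ⟨k, hk, hne⟩ := Finset.exists_ne_zero_of_sum_ne_zero h
  rcases excursionIndicator_mem i T t (ancestors K k ∩ I) with h0 | h1
  · exact absurd h0 (right_ne_zero_of_mul hne)
  · rw [← h1.2.1]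
    refine (Finset.card_le_card Finset.inter_subset_left).trans ?_
    rw [card_ancestors]
    exact Finset.le_sup (f := vertexHeight K) hk

end WRT

theorem proposition4p3
    {Ω : Type*} [MeasurableSpace Ω] (P : Measure Ω) [IsProbabilityMeasure P]
    -- the weights and the weighted recursive tree
    (w : ℕ → ℝ) (hw : ∀ n, 1 ≤ n → 0 ≤ w n) (hw1 : 0 < w 1)
    (K : ℕ → Ω → ℕ) (hK : WRT.IsWRT P w K)
    -- the time change
    (i : ℕ → ℕ) (hi : StrictMono i) (hi0 : i 0 = 1)
    -- the sequence `(T(n))_{n ≥ 2}`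
    (T : ℕ → ℕ) (hTmono : MonotoneOn T (Set.Ici 2))
    (hTlt : ∀ n, 2 ≤ n → T n < WRT.timeIndex i n) (hTtop : Tendsto T atTop atTop)
    -- the sequence `(θ_r)_{r ≥ 1}`
    (θ : ℕ → ℝ) (r₀ : ℕ) (hr₀ : 1 ≤ r₀) (hθmono : MonotoneOn θ (Set.Ici r₀))
    (hθnonneg : ∀ r, r₀ ≤ r → 0 ≤ θ r)
    -- the quotients in the second series are well defined, and both series converge
    (hE : ∀ t, 1 ≤ t → WRT.E w i θ T (i t) ≠ 0)
    (hδ₁ : ∑' t : ℕ, WRT.delta₁ w i θ T (i (t + 1)) < ∞)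
    (hδ₂ : ∑' t : ℕ,
      WRT.delta₂ w i θ T (i (t + 1)) / ENNReal.ofReal (WRT.E w i θ T (i (t + 1)) ^ 2) < ∞) :
    ∀ᵐ ω ∂P, ∀ᶠ n in atTop,
      (WRT.timeIndex i n : ℤ) - (T n : ℤ) - 1 ≤ (WRT.treeHeight (fun m => K m ω) n : ℤ) := by
  have h2 : ∀ t, 1 ≤ t → 2 ≤ i t := fun t ht => by
    have := hi (show 0 < t by omega)
    omega
  have hTi : Tendsto (fun t => T (i (t + 1))) atTop atTop :=
    hTtop.comp (hi.tendsto_atTop.comp (tendsto_add_atTop_nat 1))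
  -- From `N` on, `T(i_{t+1}) ≥ r₀`, so only the non-negative, non-decreasing part of `θ` is
  -- involved.
  obtain ⟨N, hN⟩ := eventually_atTop.1 (hTi.eventually_ge_atTop r₀)
  have hδle : ∀ t, WRT.delta₁ w i θ T (i (t + 1)) ≤
      ∑' t : ℕ, WRT.delta₁ w i θ T (i (t + 1)) := fun t => ENNReal.le_tsum t
  -- Bounding each `δ₁` by the whole series makes the constant uniform in `t`.
  set C := ENNReal.ofReal
    (Real.exp ((∑' t : ℕ, WRT.delta₁ w i θ T (i (t + 1))).toReal / 2)) with hC
  have hprob : ∀ t, P {ω | WRT.vertexAvg w (fun m => K m ω) (i (t + N + 1)) (fun s =>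
      WRT.excursionIndicator i (T (i (t + N + 1))) (t + N + 1)
        (s ∩ Finset.Ioc (i (T (i (t + N + 1)))) (i (t + N + 1)))) = 0} ≤
      C * (WRT.delta₂ w i θ T (i (t + N + 1)) /
        ENNReal.ofReal (WRT.E w i θ T (i (t + N + 1)) ^ 2)) := by
    intro t
    have hlt := hTlt (i (t + N + 1)) (h2 _ (by omega))
    rw [WRT.timeIndex_apply hi] at hlt
    refine (WRT.measure_vertexAvg_eq_zero_le hw hw1 hK hi hi0 hθmono hθnonneg hlt
      ((hN (t + N) (by omega)).trans (Nat.le_succ _)) ((hδle _).trans_lt hδ₁).ne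
      (hE _ (by omega))).trans ?_
    refine mul_le_mul_left (ENNReal.ofReal_le_ofReal (Real.exp_le_exp.2 ?_)) _
    exact div_le_div_of_nonneg_right (ENNReal.toReal_mono hδ₁.ne (hδle _)) zero_le_two
  have hsum : ∑' t, P {ω | WRT.vertexAvg w (fun m => K m ω) (i (t + N + 1)) (fun s =>
      WRT.excursionIndicator i (T (i (t + N + 1))) (t + N + 1)
        (s ∩ Finset.Ioc (i (T (i (t + N + 1)))) (i (t + N + 1)))) = 0} ≠ ∞ := by
    refine ne_top_of_le_ne_top ?_ (ENNReal.tsum_le_tsum hprob)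
    rw [ENNReal.tsum_mul_left]
    refine ENNReal.mul_ne_top ENNReal.ofReal_ne_top (ne_top_of_le_ne_top hδ₂.ne ?_)
    exact ENNReal.tsum_comp_le_tsum_of_injective (add_left_injective N) (fun t =>
      WRT.delta₂ w i θ T (i (t + 1)) / ENNReal.ofReal (WRT.E w i θ T (i (t + 1)) ^ 2))
  filter_upwards [ae_eventually_notMem hsum] with ω hω
  obtain ⟨M, hM⟩ := eventually_atTop.1 hω
  filter_upwards [eventually_gt_atTop (i (M + N + 1))] with n hn
  have ht := (WRT.lt_timeIndex_iff hi).2 hn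
  -- Here `M + d + N + 1 = t_n - 1`: the estimate is used at the end of the last block before that
  -- of `n`, which is where the `-1` is lost.
  obtain ⟨d, hd⟩ := Nat.exists_eq_add_of_lt ht
  have hheight := WRT.le_treeHeight_of_vertexAvg_ne_zero (hM (M + d) (by omega))
  have hlt : i (M + d + N + 1) < n := (WRT.lt_timeIndex_iff hi).1 (by omega)
  have hge := h2 (M + d + N + 1) (by omega)
  have hTle : T (i (M + d + N + 1)) ≤ T n :=
    hTmono (Set.mem_Ici.2 hge) (Set.mem_Ici.2 (by omega)) hlt.le
  have hmono := WRT.treeHeight_mono (fun m => K m ω) hlt.le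
  omega
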